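/- **Setting.** Let $N\ge 1$ be an integer, $\alpha,\beta>-1$ and $\mu\in(1,2)$. Let $P_n^{(a,b)}$ be the Jacobi polynomials in Szegő's normalization, $\omega^{(a,b)}(x)=(1-x)^a(1+x)^b$, and $$\gamma_n^{(a,b)}=\frac{2^{a+b+1}\Gamma(n+a+1)\Gamma(n+b+1)}{(2n+a+b+1)\,n!\,\Gamma(n+a+b+1)}=\int_{-1}^1\big(P_n^{(a,b)}\big)^2\omega^{(a,b)}\,dx$$ (for $n=0$ the product $(a+b+1)\Gamma(a+b+1)$ is read as $\Gamma(a+b+2)$). Let $-1=x_0<x_1<\dots<x_N=1$ be the Jacobi–Gauss–Lobatto nodes, i.e. the zeros of $(1-x^2)\frac{d}{dx}P_N^{(\alpha,\beta)}(x)$, and let $\omega_j=\int_{-1}^1 h_j\,\omega^{(\alpha,\beta)}dx$ be the quadrature weights, where $h_j$ are the Lagrange basis polynomials at $x_0,\dots,x_N$. For a polynomial $u$ and $-1<x<1$ put $$\big({}^R\widehat D_-^{\mu}u\big)(x)=(1+x)^\mu\,\frac{1}{\Gamma(2-\mu)}\frac{d^2}{dx^2}\int_{-1}^x\frac{u(y)}{(x-y)^{\mu-1}}\,dy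 .$$ A *modified Riemann–Liouville Birkhoff basis* is a family of real polynomials $\widehat Q_0^\mu,\dots,\widehat Q_N^\mu$ of degree at most $N$ with $$\big({}^R\widehat D_-^{\mu}\widehat Q_j^\mu\big)(x_i)=\delta_{ij}\ (1\le i\le N-1),\qquad \widehat Q_j^\mu(-1)=\delta_{0j},\qquad \widehat Q_j^\mu(1)=\delta_{Nj}\qquad(0\le j\le N).$$ **Coefficients.** For $0\le n\le N-1$ let $$\varrho_{n0}=\frac1{\gamma_n^{(\alpha,\beta)}}\Big\{P_n^{(\alpha,\beta)}(-1)\omega_0-\frac{\beta+1}{\alpha+1}\frac{P_N^{(\alpha,\beta)}(1)}{P_N^{(\alpha,\beta)}(-1)}P_n^{(\alpha,\beta)}(1)\omega_N\Big\},$$ $$\varrho_{nj}=\frac1{\gamma_n^{(\alpha,\beta)}}\Big\{P_n^{(\alpha,\beta)}(x_j)\omega_j-\frac{1}{\alpha+1}\frac{P_N^{(\alpha,\beta)}(1)}{P_N^{(\alpha,\beta)}(x_j)}P_n^{(\alpha,\beta)}(1)\omega_N\Big\}\quad(1\le j\le N-1),$$ and, for $0\le l,j\le N-1$, $$\tilde\varrho_{lj}=\sum_{n=l}^{N-1}C_{ln}\,\varrho_{nj},\qquad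 C_{ln}=\frac1{\gamma_l^{(\mu,1-\mu)}}\int_{-1}^1P_l^{(\mu,1-\mu)}P_n^{(\alpha,\beta)}\,\omega^{(\mu,1-\mu)}dx .$$ With $$a_l=\frac{l+1}{2l+1},\quad b_l=\frac{1-2\mu}{(2l+1)(2l+3)},\quad c_{l-1}=\frac{(l+\mu)(l-\mu+1)}{(l+1)(2l+1)}\ (l\ge1),\quad c_{-1}=0,$$ define $\hat\varrho_{ij}$ for $1\le i\le N-1$ by the backward recurrence $$\hat\varrho_{ij}=\frac{1}{a_i}\tilde\varrho_{ij}-\frac{b_i+1}{a_i}\hat\varrho_{i+1,j}-\frac{c_i}{a_i}\hat\varrho_{i+2,j},\qquad i=N-1,N-2,\dots,1,\qquad \hat\varrho_{N,j}=\hat\varrho_{N+1,j}=0 .$$ Finally let $$d_l^\mu=\frac{\Gamma(l+2-\mu)}{(l+1)!},\quad \varphi_l(x)=(1+x)P_l^{(0,1)}(x),\quad S=\sum_{l=0}^{N-1}d_l^\mu\tilde\varrho_{l0},\quad S_j=\sum_{l=0}^{N-2}d_l^\mu\hat\varrho_{l+1,j}\ (0\le j\le N-1).$$ **Theorem.** If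 $S\ne0$, there is exactly one modified Riemann–Liouville Birkhoff basis. Conversely, if $\{\widehat Q_j^\mu\}_{j=0}^N$ is such a basis, then $S\neq0$ and the following formulas hold. (i) For $j=0$, $$\widehat Q_0^\mu=1+\Big(\tau_0-\frac1{\Gamma(1-\mu)}\Big)\sum_{l=0}^{N-1}d_l^\mu\tilde\varrho_{l0}\,\varphi_l+\frac1{\Gamma(1-\mu)}\sum_{l=0}^{N-2}d_l^\mu\hat\varrho_{l+1,0}\,\varphi_l,\qquad \tau_0-\frac1{\Gamma(1-\mu)}=-\Big\{\frac12+\frac{S_0}{\Gamma(1-\mu)}\Big\}\Big/S .$$ (ii) For $j=N$, $\displaystyle \widehat Q_N^\mu=\frac1{2S}\sum_{l=0}^{N-1}d_l^\mu\tilde\varrho_{l0}\,\varphi_l .$ (iii) For every $1\le j\le N-1$ with $S_j\ne0$, put $\tau_j=-1+\mu\,\Gamma(2-\mu)\,\hat\varrho_{1j}/S_j$. Then $x_j+\tau_j\neq0$ and $$\widehat Q_j^\mu=\frac{\tau_j}{x_j+\tau_j}\sum_{l=0}^{N-2}d_l^\mu\hat\varrho_{l+1,j}\,\varphi_l+\frac1{x_j+\tau_j}\sum_{l=0}^{N-2}d_l^\mu\hat\varrho_{l+1,j}\Big\{\frac{l+2-\mu}{l+2}a_{l+1}\varphi_{l+1}+b_l\varphi_l+\frac{l+1}{l+1-\mu}c_{l-1}\varphi_{l-1}\Big\},$$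 where the $\varphi_{l-1}$ term is absent for $l=0$. -/

import Mathlib

open Polynomial

noncomputable section

namespace FracBirkhoff

/-- The left-sided Riemann-Liouville fractional integral of order `ρ > 0` based at `-1`. -/
def rlIntegral (ρ : ℝ) (u : ℝ → ℝ) (x : ℝ) : ℝ :=
  1 / Real.Gamma ρ * ∫ y in (-1 : ℝ)..x, u y / (x - y) ^ (1 - ρ)

/-- The left-sided Riemann-Liouville fractional derivative based at `-1`, of order
`μ ∈ (k - 1, k)` with `k = ⌈μ⌉`: the `k`-th derivative of the integral of order `k - μ`. -/
def rlDeriv (μ : ℝ) (u : ℝ → ℝ) (x : ℝ) : ℝ :=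
  iteratedDeriv ⌈μ⌉₊ (rlIntegral ((⌈μ⌉₊ : ℝ) - μ) u) x

/-- The modified Riemann-Liouville derivative: the singular factor at `-1` is removed. -/
def modRlDeriv (μ : ℝ) (u : ℝ → ℝ) (x : ℝ) : ℝ :=
  (1 + x) ^ μ * rlDeriv μ u x

/-- The Jacobi polynomial `P_n^{(α,β)}` in Szegő's normalization,
`∑_k (n+α+β+1)_k (α+k+1)_{n-k} / (k! (n-k)!) ((x-1)/2)^k` with Pochhammer symbols
(the terminating hypergeometric series, written without division by `(α+1)_k`). -/
def jacobi (α β : ℝ) (n : ℕ) : ℝ[X] :=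
  ∑ k ∈ Finset.range (n + 1),
    C ((ascPochhammer ℝ k).eval (n + α + β + 1) * (ascPochhammer ℝ (n - k)).eval (α + k + 1)
        / ((k.factorial : ℝ) * ((n - k).factorial : ℝ))) *
      (C (1 / 2) * (X - 1)) ^ k

/-- The Jacobi weight function. -/
def jacobiWeight (α β x : ℝ) : ℝ := (1 - x) ^ α * (1 + x) ^ β

/-- The normalization constant `γ_n^{(α,β)} = ∫ (P_n^{(α,β)})² ω^{(α,β)}` in closed form.
For `n = 0` the product `(α+β+1) Γ(α+β+1)` is written `Γ(α+β+2)`, which also covers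
`α + β = -1`. -/
def jacobiGamma (α β : ℝ) (n : ℕ) : ℝ :=
  if n = 0 then
    2 ^ (α + β + 1) * Real.Gamma (α + 1) * Real.Gamma (β + 1) / Real.Gamma (α + β + 2)
  else
    2 ^ (α + β + 1) * Real.Gamma (n + α + 1) * Real.Gamma (n + β + 1) /
      ((2 * n + α + β + 1) * n.factorial * Real.Gamma (n + α + β + 1))

/-- The connection coefficient from `(α, β)` to `(a, b)`, with row `l` and column `n`. -/
def connCoeff (α β a b : ℝ) (l n : ℕ) : ℝ :=
  1 / jacobiGamma a b l *
    ∫ x in (-1 : ℝ)..1, (jacobi a b l).eval x * (jacobi α β n).eval x * jacobiWeight a b x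

/-- `x_0 < ... < x_N` are the Jacobi-Gauss-Lobatto nodes: the zeros of
`(1 - x²) D P_N^{(α,β)}(x)` in ascending order, with `x_0 = -1` and `x_N = 1`. -/
structure IsJGLNodes (α β : ℝ) (N : ℕ) (x : Fin (N + 1) → ℝ) : Prop where
  strictMono : StrictMono x
  zeros : ∀ y : ℝ, ((1 - X ^ 2) * derivative (jacobi α β N)).IsRoot y ↔ ∃ j, x j = y
  first : x 0 = -1
  last : x (Fin.last N) = 1

/-- The quadrature weights: integrals of the Lagrange basis polynomials at all nodes. -/
def quadWeight (α β : ℝ) {N : ℕ} (x : Fin (N + 1) → ℝ) (j : Fin (N + 1)) : ℝ :=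
  ∫ y in (-1 : ℝ)..1, (Lagrange.basis Finset.univ x j).eval y * jacobiWeight α β y

/-- `a_i` for `i ≥ 1` in the three-term recurrence of `P_l^{(μ,1-μ)}`. -/
def recA (i : ℕ) : ℝ := (i + 1) / (2 * i + 1)

/-- `b_i` in the three-term recurrence of `P_l^{(μ,1-μ)}`. -/
def recB (μ : ℝ) (i : ℕ) : ℝ := (1 - 2 * μ) / ((2 * i + 1) * (2 * i + 3))

/-- `c_{l-1}` in the three-term recurrence of `P_l^{(μ,1-μ)}`, as a function of `l`,
with `c_{-1} = 0`; thus `c_i` is `recCPred μ (i + 1)`. -/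
def recCPred (μ : ℝ) (l : ℕ) : ℝ :=
  if l = 0 then 0 else (l + μ) * (l - μ + 1) / ((l + 1) * (2 * l + 1))

/-- The coefficients `ϱ_{nj}`, for `0 ≤ n, j ≤ N - 1`. -/
def rho (α β : ℝ) {N : ℕ} (x : Fin (N + 1) → ℝ) (n : ℕ) (j : Fin (N + 1)) : ℝ :=
  if j = 0 then
    1 / jacobiGamma α β n *
      ((jacobi α β n).eval (-1) * quadWeight α β x 0
        - (β + 1) / (α + 1) * ((jacobi α β N).eval 1 / (jacobi α β N).eval (-1))
          * (jacobi α β n).eval 1 * quadWeight α β x (Fin.last N))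
  else
    1 / jacobiGamma α β n *
      ((jacobi α β n).eval (x j) * quadWeight α β x j
        - 1 / (α + 1) * ((jacobi α β N).eval 1 / (jacobi α β N).eval (x j))
          * (jacobi α β n).eval 1 * quadWeight α β x (Fin.last N))

/-- The coefficients `ϱ̃_{lj}`, for `0 ≤ l, j ≤ N - 1`. -/
def rhoTilde (α β μ : ℝ) {N : ℕ} (x : Fin (N + 1) → ℝ) (l : ℕ) (j : Fin (N + 1)) : ℝ :=
  ∑ n ∈ Finset.Ico l N, connCoeff α β μ (1 - μ) l n * rho α β x n j

/-- The backward recurrence for right-hand side `t` and last index `M`, listed from the top: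
the value at `k` is the entry with index `M - k`. -/
def backSolve (μ : ℝ) (t : ℕ → ℝ) (M : ℕ) : ℕ → ℝ
  | 0 => 1 / recA M * t M
  | 1 => 1 / recA (M - 1) * t (M - 1)
      - (recB μ (M - 1) + 1) / recA (M - 1) * backSolve μ t M 0
  | k + 2 => 1 / recA (M - (k + 2)) * t (M - (k + 2))
      - (recB μ (M - (k + 2)) + 1) / recA (M - (k + 2)) * backSolve μ t M (k + 1)
      - recCPred μ (M - (k + 2) + 1) / recA (M - (k + 2)) * backSolve μ t M k

/-- The coefficients `ϱ̂_{ij}`, for `0 ≤ i, j ≤ N - 1`. -/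
def rhoHat (α β μ : ℝ) {N : ℕ} (x : Fin (N + 1) → ℝ) (i : ℕ) (j : Fin (N + 1)) : ℝ :=
  if i = 0 then (if j = 0 then 1 else 0)
  else backSolve μ (fun l => rhoTilde α β μ x l j) (N - 1) (N - 1 - i)

/-- `d_l^μ = Γ(l+2-μ) / (l+1)!`. -/
def dCoeff (μ : ℝ) (l : ℕ) : ℝ := Real.Gamma (l + 2 - μ) / ((l + 1).factorial : ℝ)

/-- `φ_l = (1 + x) P_l^{(0,1)}`. -/
def phi (l : ℕ) : ℝ[X] := (1 + X) * jacobi 0 1 l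

/-- The modified Riemann-Liouville Birkhoff interpolating basis polynomials of order
`μ ∈ (1, 2)` at the nodes `x_0, ..., x_N`. -/
structure IsBirkhoffBasis (μ : ℝ) {N : ℕ} (x : Fin (N + 1) → ℝ)
    (Q : Fin (N + 1) → ℝ[X]) : Prop where
  natDegree_le : ∀ j, (Q j).natDegree ≤ N
  modRlDeriv_eq : ∀ i j, i ≠ 0 → i ≠ Fin.last N →
    modRlDeriv μ (fun y => (Q j).eval y) (x i) = if i = j then 1 else 0
  eval_neg_one : ∀ j, (Q j).eval (-1) = if j = 0 then 1 else 0
  eval_one : ∀ j, (Q j).eval 1 = if j = Fin.last N then 1 else 0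

/-- `∑_{l=0}^{N-1} d_l^μ ϱ̃_{l0}`. -/
def tildeSum (α β μ : ℝ) {N : ℕ} (x : Fin (N + 1) → ℝ) : ℝ :=
  ∑ l ∈ Finset.range N, dCoeff μ l * rhoTilde α β μ x l 0

/-- `∑_{l=0}^{N-2} d_l^μ ϱ̂_{l+1,j}`. -/
def hatSum (α β μ : ℝ) {N : ℕ} (x : Fin (N + 1) → ℝ) (j : Fin (N + 1)) : ℝ :=
  ∑ l ∈ Finset.range (N - 1), dCoeff μ l * rhoHat α β μ x (l + 1) j

/-- The constant `τ_0`. -/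
def tauZero (α β μ : ℝ) {N : ℕ} (x : Fin (N + 1) → ℝ) : ℝ :=
  1 / Real.Gamma (1 - μ)
    - (1 / 2 + 1 / Real.Gamma (1 - μ) * hatSum α β μ x 0) / tildeSum α β μ x

/-- The constants `τ_j` for `1 ≤ j ≤ N - 1`. -/
def tau (α β μ : ℝ) {N : ℕ} (x : Fin (N + 1) → ℝ) (j : Fin (N + 1)) : ℝ :=
  -1 + μ * Real.Gamma (2 - μ) * rhoHat α β μ x 1 j / hatSum α β μ x j

end FracBirkhoff

end

/-! The modified derivative acts diagonally on powers of `1 + x`: `(1+x)^k` is multiplied by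
`Γ(k+1)/Γ(k+1-μ)`. Hence every polynomial of degree at most `N` is uniquely `q + lift μ p` with `q`
its value at `-1` and `deg p < N`, and its modified derivative is `q/Γ(1-μ) + (1+x) p`
(`modRlDeriv_add_lift`, `exists_eq_C_add_lift`). The interior conditions become interpolation
conditions on `p` at `x_1, ..., x_{N-1}`, and the condition at `-1` fixes `q`.

One degree of freedom remains: `p` is known up to a multiple of the cardinal polynomial `v` of `x_0`
among `x_0, ..., x_{N-1}`. It has to be fixed by the value at `1`. Since `(lift μ v)(1) = 2S`, the
problem is uniquely solvable exactly when `S ≠ 0` (`IsJGLNodes.eq_of_lift_eq`,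
`exists_isBirkhoffBasis`, `IsBirkhoffBasis.tildeSum_ne_zero`).

For the formulas, `ϱ` and `ϱ̃` are the Jacobi coefficients of the cardinal polynomials for `(α, β)`
and `(μ, 1-μ)`. The `ϱ̂` are those of their quotients by `1 + x`, after removal of the value at `-1`
(`IsJGLNodes.cardinal_eq_hatPoly`). Since `lift` sends `P_l^{(μ,1-μ)}` to `d_l φ_l` (`lift_jacobi`)
and `φ_l(1) = 2`, both the expansions and the values at `1` can be read off. Each formula is then
verified by `IsBirkhoffBasis.eq_C_add_lift`. -/

noncomputable section

namespace FracBirkhoff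

/-! ### Jacobi polynomials: derivative, differential equation, reflection. -/

section

/-- The coefficients of the Jacobi polynomial in powers of `(x - 1) / 2`. -/
def jacobiCoeff (a b : ℝ) (n k : ℕ) : ℝ :=
  (ascPochhammer ℝ k).eval (n + a + b + 1) * (ascPochhammer ℝ (n - k)).eval (a + k + 1)
        / ((k.factorial : ℝ) * ((n - k).factorial : ℝ))

/-- The Jacobi polynomial in the variable `(x - 1) / 2`. -/
def shiftedJacobi (a b : ℝ) (n : ℕ) : ℝ[X] :=
  ∑ k ∈ Finset.range (n + 1), C (jacobiCoeff a b n k) * X ^ k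

lemma jacobi_eq_comp (a b : ℝ) (n : ℕ) :
    jacobi a b n = (shiftedJacobi a b n).comp (C (1 / 2) * (X - 1)) := by
  simp [jacobi, shiftedJacobi, jacobiCoeff, Polynomial.sum_comp]

lemma coeff_shiftedJacobi (a b : ℝ) (n k : ℕ) :
    (shiftedJacobi a b n).coeff k = if k ≤ n then jacobiCoeff a b n k else 0 := by
  simp [shiftedJacobi, Polynomial.coeff_X_pow]

lemma ascPochhammer_eval_succ_left (k : ℕ) (x : ℝ) :
    (ascPochhammer ℝ (k + 1)).eval x = x * (ascPochhammer ℝ k).eval (x + 1) := by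
  rw [ascPochhammer_succ_left]; simp

lemma derivative_shiftedJacobi (a b : ℝ) (n : ℕ) :
    derivative (shiftedJacobi a b (n + 1)) =
      C (n + a + b + 2) * shiftedJacobi (a + 1) (b + 1) n := by
  ext k
  rw [coeff_derivative, coeff_C_mul, coeff_shiftedJacobi, coeff_shiftedJacobi]
  by_cases h : k ≤ n
  · rw [if_pos (by omega), if_pos h]
    unfold jacobiCoeff
    rw [ascPochhammer_eval_succ_left, Nat.factorial_succ, Nat.add_sub_add_right]
    push_cast
    rw [show (n : ℝ) + 1 + a + b + 1 + 1 = n + (a + 1) + (b + 1) + 1 by ring,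
      show a + ((k : ℝ) + 1) + 1 = a + 1 + k + 1 by ring]
    have := Nat.factorial_ne_zero k
    have := Nat.factorial_ne_zero (n - k)
    field_simp
    ring
  · rw [if_neg (by omega), if_neg h]; simp

lemma derivative_jacobi (a b : ℝ) (n : ℕ) :
    derivative (jacobi a b (n + 1)) = C ((n + a + b + 2) / 2) * jacobi (a + 1) (b + 1) n := by
  rw [jacobi_eq_comp, derivative_comp, derivative_shiftedJacobi, jacobi_eq_comp]
  simp only [mul_comp, C_comp, derivative_mul, derivative_C, derivative_sub, derivative_X,
    derivative_one, div_eq_mul_inv, C_mul]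
  simp
  ring

/-- The term ratio of the hypergeometric series, cross-multiplied so that it needs no condition on
`a`. -/
lemma jacobiCoeff_succ (a b : ℝ) (n k : ℕ) (h : k < n) :
    jacobiCoeff a b n (k + 1) * ((k + 1) * (k + a + 1)) =
      jacobiCoeff a b n k * ((n - k) * (n + k + a + b + 1)) := by
  obtain ⟨m, rfl⟩ : ∃ m, n = k + m + 1 := ⟨n - k - 1, by omega⟩
  unfold jacobiCoeff
  rw [ascPochhammer_succ_eval, show k + m + 1 - (k + 1) = m by omega,
    show k + m + 1 - k = m + 1 by omega, ascPochhammer_eval_succ_left m, Nat.factorial_succ,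
    Nat.factorial_succ]
  push_cast
  rw [show a + ((k : ℝ) + 1) + 1 = a + k + 1 + 1 by ring]
  have := Nat.factorial_ne_zero k
  have := Nat.factorial_ne_zero m
  field_simp
  ring

/-- Coefficientwise this is `jacobiCoeff_succ`; at the top degree the factor `n - k` vanishes, which
is where the series terminates. -/
lemma shiftedJacobi_ode (a b : ℝ) (n : ℕ) :
    C (-1) * ((X + X ^ 2) * derivative (derivative (shiftedJacobi a b n)))
      - (C (a + 1) + C (a + b + 2) * X) * derivative (shiftedJacobi a b n)
      + C (n * (n + a + b + 1)) * shiftedJacobi a b n = 0 := by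
  have key : ∀ k : ℕ, (shiftedJacobi a b n).coeff (k + 1) * ((k + 1) * (k + a + 1)) =
      (shiftedJacobi a b n).coeff k * ((n - k) * (n + k + a + b + 1)) := by
    intro k
    simp only [coeff_shiftedJacobi]
    rcases lt_trichotomy k n with h | h | h
    · rw [if_pos (by omega), if_pos h.le, jacobiCoeff_succ a b n k h]
    · rw [if_neg (by omega), h]; simp
    · rw [if_neg (by omega), if_neg (by omega)]; simp
  ext k
  have hk := key k
  rcases k with _ | _ | k
  · simp [add_mul, coeff_derivative, mul_assoc, pow_two] at hk ⊢
    linarith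
  · simp [add_mul, coeff_derivative, mul_assoc, pow_two, coeff_X_mul] at hk ⊢
    linarith
  · simp [add_mul, coeff_derivative, mul_assoc, pow_two, coeff_X_mul] at hk ⊢
    linarith

lemma jacobi_ode (a b : ℝ) (n : ℕ) :
    (1 - X ^ 2) * derivative (derivative (jacobi a b n))
      + (C (b - a) - C (a + b + 2) * X) * derivative (jacobi a b n)
      + C (n * (n + a + b + 1)) * jacobi a b n = 0 := by
  have h := congrArg (fun p => p.comp (C (1 / 2) * (X - 1))) (shiftedJacobi_ode a b n)
  have hd : derivative (C (1 / 2 : ℝ) * (X - 1)) = C (1 / 2) := by simp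
  have hC : (C (1 / 2 : ℝ)) * 2 = 1 := by
    rw [show (2 : ℝ[X]) = C 2 by rfl, ← C_mul]; norm_num
  simp only [add_comp, sub_comp, mul_comp, C_comp, X_comp, pow_comp, zero_comp] at h
  rw [jacobi_eq_comp, derivative_comp, derivative_mul, derivative_comp, hd]
  rw [← h]
  simp only [C_sub, C_add, derivative_C, C_neg, C_1, C_ofNat]
  -- With `t = (x-1)/2` one has `1 - x² = -4(t + t²)`. Only `2c = 1` is used about `c`, so the rest
  -- is a ring identity modulo that relation.
  generalize (C (1 / 2) : ℝ[X]) = c at *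
  have hX : (X : ℝ[X]) = 1 + 2 * (c * (X - 1)) := by linear_combination (1 - X) * hC
  generalize c * (X - 1) = t at *
  rw [hX]
  generalize (derivative (derivative (shiftedJacobi a b n))).comp t = u
  generalize (derivative (shiftedJacobi a b n)).comp t = v
  generalize (shiftedJacobi a b n).comp t = w
  linear_combination (-v * C a - v - t * (C a + C b + 2) * v - u * (t + t^2) * (2*c+1)) * hC

lemma natDegree_shiftedJacobi_le (a b : ℝ) (n : ℕ) : (shiftedJacobi a b n).natDegree ≤ n := by
  rw [natDegree_le_iff_coeff_eq_zero]
  intro k hk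
  rw [coeff_shiftedJacobi, if_neg (by omega)]

lemma natDegree_half_X_sub_one : (C (1 / 2 : ℝ) * (X - 1)).natDegree = 1 := by
  rw [natDegree_C_mul (by norm_num)]; exact natDegree_X_sub_C 1

lemma natDegree_jacobi_le (a b : ℝ) (n : ℕ) : (jacobi a b n).natDegree ≤ n := by
  rw [jacobi_eq_comp, natDegree_comp, natDegree_half_X_sub_one, mul_one]
  exact natDegree_shiftedJacobi_le a b n

/-- The leading coefficient of the Jacobi polynomial. -/
lemma coeff_jacobi_self (a b : ℝ) (n : ℕ) :
    (jacobi a b n).coeff n =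
      (ascPochhammer ℝ n).eval (n + a + b + 1) / n.factorial * (1 / 2) ^ n := by
  have h : (jacobi a b n).coeff n = ∑ k ∈ Finset.range (n + 1),
      jacobiCoeff a b n k * ((C (1 / 2 : ℝ) * (X - 1)) ^ k).coeff n := by
    simp only [jacobi, finsetSum_coeff, coeff_C_mul]; rfl
  rw [h, Finset.sum_eq_single n]
  · rw [mul_pow, ← C_pow, coeff_C_mul]
    have : ((X - 1 : ℝ[X]) ^ n).coeff n = 1 := by
      have h1 : (X - 1 : ℝ[X]) = X - C 1 := by simp
      rw [h1]
      have := (monic_X_sub_C (1 : ℝ)).pow n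
      have h2 := this.coeff_natDegree
      rwa [natDegree_pow, natDegree_X_sub_C, mul_one] at h2
    rw [this]; simp [jacobiCoeff]
  · intro k hk hkn
    rw [coeff_eq_zero_of_natDegree_lt, mul_zero]
    rw [natDegree_pow, natDegree_half_X_sub_one]
    simp at hk; omega
  · simp

lemma coeff_jacobi_self_ne_zero {a b : ℝ} (ha : -1 < a) (hb : -1 < b) (n : ℕ) :
    (jacobi a b n).coeff n ≠ 0 := by
  rw [coeff_jacobi_self]
  rcases n with _ | n
  · simp
  · have h : 0 < (ascPochhammer ℝ (n + 1)).eval (((n + 1 : ℕ) : ℝ) + a + b + 1) := by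
      apply ascPochhammer_pos
      push_cast
      have : (0 : ℝ) ≤ n := n.cast_nonneg
      linarith
    have := Nat.factorial_pos (n + 1)
    positivity

lemma eval_one_jacobi (a b : ℝ) (n : ℕ) :
    (jacobi a b n).eval 1 = (ascPochhammer ℝ n).eval (a + 1) / n.factorial := by
  rw [jacobi_eq_comp, eval_comp]
  simp only [eval_mul, eval_C, eval_sub, eval_X, eval_one, sub_self, mul_zero]
  rw [← coeff_zero_eq_eval_zero, coeff_shiftedJacobi]
  simp [jacobiCoeff]

/-- A polynomial solution of the Jacobi equation of index `n` with degree less than `n`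
vanishes. -/
lemma eq_zero_of_jacobi_ode {a b : ℝ} (ha : -1 < a) (hb : -1 < b) (n : ℕ) (p : ℝ[X])
    (hp : p.degree < n)
    (h : (1 - X ^ 2) * derivative (derivative p)
      + (C (b - a) - C (a + b + 2) * X) * derivative p + C (n * (n + a + b + 1)) * p = 0) :
    p = 0 := by
  by_contra hne
  set m := p.natDegree with hm
  have hmn : m < n := by rwa [degree_eq_natDegree hne, Nat.cast_lt] at hp
  have hlead : p.coeff m ≠ 0 := by simpa [hm] using hne
  have hz : ∀ k, m < k → p.coeff k = 0 := fun k hk => coeff_eq_zero_of_natDegree_lt hk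
  have hc := congrArg (fun q => q.coeff m) h
  -- The coefficient of `X^m` carries `n(n+a+b+1) - m(m+a+b+1)`, which factors as shown. The values
  -- `m = 0, 1` are separate because the terms with `X` and `X²` shift indices below zero.
  have hcoef : (((n : ℝ) - m) * (n + m + a + b + 1)) * p.coeff m = 0 := by
    rcases hm' : m with _ | _ | k
    · rw [hm'] at hc hz
      simp [sub_mul, add_mul, coeff_derivative, mul_assoc, pow_two, hz] at hc
      simp only [Nat.cast_zero, sub_zero, add_zero]
      rcases hc with hc | hc
      · simp [hc]
      · linear_combination (n : ℝ) * hc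
    · rw [hm'] at hc hz
      simp [sub_mul, add_mul, coeff_derivative, mul_assoc, pow_two, coeff_X_mul, hz] at hc
      push_cast; linarith
    · rw [hm'] at hc hz
      simp [sub_mul, add_mul, coeff_derivative, mul_assoc, pow_two, coeff_X_mul, hz] at hc
      push_cast; linarith
  have h1 : (0 : ℝ) < n - m := by
    have : (m : ℝ) < n := by exact_mod_cast hmn
    linarith
  have h2 : (0 : ℝ) < n + m + a + b + 1 := by
    have : (1 : ℝ) ≤ n := by exact_mod_cast (by omega : 1 ≤ n)
    have : (0 : ℝ) ≤ m := m.cast_nonneg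
    linarith
  have := mul_pos h1 h2
  exact (mul_ne_zero this.ne' hlead) hcoef

lemma natDegree_sub_lt_of_coeff_eq {p q : ℝ[X]} {n : ℕ} (hp : p.natDegree ≤ n)
    (hq : q.natDegree ≤ n) (h : p.coeff n = q.coeff n) : (p - q).degree < n := by
  rw [degree_lt_iff_coeff_zero]
  intro m hm
  rcases hm.eq_or_lt with rfl | hm
  · simp [h]
  · rw [coeff_sub, coeff_eq_zero_of_natDegree_lt (by omega),
      coeff_eq_zero_of_natDegree_lt (by omega), sub_zero]

lemma coeff_comp_neg_variable (p : ℝ[X]) (n : ℕ) : (p.comp (-X)).coeff n = (-1) ^ n * p.coeff n := by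
  have : (-X : ℝ[X]) = C (-1) * X := by simp
  rw [this, comp_C_mul_X_coeff, mul_comm]

/-- The reflection formula for Jacobi polynomials. -/
lemma jacobi_comp_neg {a b : ℝ} (ha : -1 < a) (hb : -1 < b) (n : ℕ) :
    jacobi a b n = C ((-1) ^ n) * (jacobi b a n).comp (-X) := by
  rw [← sub_eq_zero]
  -- Both sides solve the same equation and share the leading coefficient, so their difference has
  -- degree below `n`.
  apply eq_zero_of_jacobi_ode ha hb n
  · apply natDegree_sub_lt_of_coeff_eq (natDegree_jacobi_le a b n)
    · apply (natDegree_C_mul_le _ _).trans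
      rw [natDegree_comp]
      simpa using natDegree_jacobi_le b a n
    · rw [coeff_C_mul, coeff_comp_neg_variable, coeff_jacobi_self, coeff_jacobi_self, ← mul_assoc,
        ← mul_pow]
      norm_num
      congr 2; ring
  · have h1 := jacobi_ode a b n
    have h2 := congrArg (fun p => p.comp (-X)) (jacobi_ode b a n)
    simp only [add_comp, sub_comp, mul_comp, C_comp, X_comp, pow_comp, zero_comp, one_comp] at h2
    simp only [derivative_sub, derivative_mul, derivative_C, derivative_comp, derivative_neg,
      derivative_X, zero_mul, zero_add, derivative_one, neg_zero]
    simp only [C_sub, C_add, C_mul] at h1 h2 ⊢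
    linear_combination h1 - C ((-1) ^ n) * h2

end

/-! ### Beta integrals, orthogonality and Jacobi expansions. -/

section

open MeasureTheory Set

lemma integral_beta {u v : ℝ} (hu : 0 < u) (hv : 0 < v) :
    ∫ x in (0 : ℝ)..1, x ^ (u - 1) * (1 - x) ^ (v - 1) =
      Real.Gamma u * Real.Gamma v / Real.Gamma (u + v) := by
  have h : ((∫ x in (0 : ℝ)..1, x ^ (u - 1) * (1 - x) ^ (v - 1) : ℝ) : ℂ) =
      Complex.betaIntegral u v := by
    rw [Complex.betaIntegral, ← intervalIntegral.integral_ofReal]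
    apply intervalIntegral.integral_congr
    intro x hx
    rw [uIcc_of_le zero_le_one] at hx
    have h1 : (0 : ℝ) ≤ 1 - x := by linarith [hx.2]
    simp only
    rw [Complex.ofReal_mul, Complex.ofReal_cpow hx.1, Complex.ofReal_cpow h1]
    push_cast; rfl
  rw [Complex.betaIntegral_eq_Gamma_mul_div _ _ (by simpa) (by simpa), ← Complex.ofReal_add,
    Complex.Gamma_ofReal, Complex.Gamma_ofReal, Complex.Gamma_ofReal] at h
  exact_mod_cast h

/-- The Beta integral over an arbitrary interval. -/
lemma integral_beta_interval {u v c d : ℝ} (hu : 0 < u) (hv : 0 < v) (hcd : c < d) :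
    ∫ y in c..d, (y - c) ^ (u - 1) * (d - y) ^ (v - 1) =
      (d - c) ^ (u + v - 1) * (Real.Gamma u * Real.Gamma v / Real.Gamma (u + v)) := by
  have hd : 0 < d - c := by linarith
  have h := intervalIntegral.integral_comp_mul_add (a := 0) (b := 1)
    (fun y : ℝ => (y - c) ^ (u - 1) * (d - y) ^ (v - 1)) hd.ne' c
  simp only [mul_zero, zero_add, mul_one, sub_add_cancel, smul_eq_mul] at h
  have h2 : ∫ x in (0 : ℝ)..1, ((d - c) * x + c - c) ^ (u - 1) * (d - ((d - c) * x + c)) ^ (v - 1)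
      = (d - c) ^ (u + v - 2) * ∫ x in (0 : ℝ)..1, x ^ (u - 1) * (1 - x) ^ (v - 1) := by
    rw [← intervalIntegral.integral_const_mul]
    apply intervalIntegral.integral_congr
    intro x hx
    rw [uIcc_of_le zero_le_one] at hx
    have h1 : (0 : ℝ) ≤ 1 - x := by linarith [hx.2]
    simp only
    rw [add_sub_cancel_right, show d - ((d - c) * x + c) = (d - c) * (1 - x) by ring,
      Real.mul_rpow hd.le hx.1, Real.mul_rpow hd.le h1,
      show u + v - 2 = (u - 1) + (v - 1) by ring, Real.rpow_add hd]
    ring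
  rw [h2, integral_beta hu hv] at h
  rw [show u + v - 1 = (u + v - 2) + 1 by ring, Real.rpow_add hd, Real.rpow_one]
  rw [eq_inv_mul_iff_mul_eq₀ hd.ne'] at h
  linarith

/-- A non-integrable function has integral `0` by convention, whereas the Beta integral is positive.
-/
lemma intervalIntegrable_beta_interval {u v c d : ℝ} (hu : 0 < u) (hv : 0 < v) (hcd : c < d) :
    IntervalIntegrable (fun y : ℝ => (y - c) ^ (u - 1) * (d - y) ^ (v - 1)) volume c d := by
  by_contra hne
  have h := integral_beta_interval hu hv hcd
  rw [intervalIntegral.integral_undef hne] at h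
  have h1 : 0 < (d - c) ^ (u + v - 1) := Real.rpow_pos_of_pos (by linarith) _
  have := Real.Gamma_pos_of_pos hu
  have := Real.Gamma_pos_of_pos hv
  have := Real.Gamma_pos_of_pos (add_pos hu hv)
  have : 0 < (d - c) ^ (u + v - 1) * (Real.Gamma u * Real.Gamma v / Real.Gamma (u + v)) := by
    positivity
  linarith

/-- The linear functional of integration against the Jacobi weight. -/
def weightedIntegral (a b : ℝ) (p : ℝ[X]) : ℝ :=
  ∫ x in (-1 : ℝ)..1, p.eval x * jacobiWeight a b x

variable {a b : ℝ}

lemma intervalIntegrable_jacobiWeight (ha : -1 < a) (hb : -1 < b) :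
    IntervalIntegrable (jacobiWeight a b) volume (-1) 1 := by
  have h := intervalIntegrable_beta_interval (u := b + 1) (v := a + 1) (c := -1) (d := 1)
    (by linarith) (by linarith) (by norm_num)
  refine h.congr ?_
  intro x _
  simp only [jacobiWeight, add_sub_cancel_right]
  rw [mul_comm, sub_neg_eq_add, add_comm x]

lemma intervalIntegrable_eval_mul_jacobiWeight (ha : -1 < a) (hb : -1 < b) (p : ℝ[X]) :
    IntervalIntegrable (fun x => p.eval x * jacobiWeight a b x) volume (-1) 1 :=
  (intervalIntegrable_jacobiWeight ha hb).continuousOn_mul p.continuous.continuousOn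

lemma weightedIntegral_add (ha : -1 < a) (hb : -1 < b) (p q : ℝ[X]) :
    weightedIntegral a b (p + q) = weightedIntegral a b p + weightedIntegral a b q := by
  unfold weightedIntegral
  rw [← intervalIntegral.integral_add (intervalIntegrable_eval_mul_jacobiWeight ha hb p)
    (intervalIntegrable_eval_mul_jacobiWeight ha hb q)]
  simp only [eval_add, add_mul]

lemma weightedIntegral_C_mul (a b c : ℝ) (p : ℝ[X]) :
    weightedIntegral a b (C c * p) = c * weightedIntegral a b p := by
  unfold weightedIntegral
  rw [← intervalIntegral.integral_const_mul]
  simp only [eval_mul, eval_C, mul_assoc]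

lemma weightedIntegral_zero (a b : ℝ) : weightedIntegral a b 0 = 0 := by
  simp [weightedIntegral]

lemma weightedIntegral_sum (ha : -1 < a) (hb : -1 < b) {ι : Type*} (s : Finset ι)
    (f : ι → ℝ[X]) :
    weightedIntegral a b (∑ i ∈ s, f i) = ∑ i ∈ s, weightedIntegral a b (f i) := by
  classical
  induction s using Finset.induction_on with
  | empty => simp [weightedIntegral_zero]
  | insert i s hi ih => rw [Finset.sum_insert hi, Finset.sum_insert hi,
      weightedIntegral_add ha hb, ih]

lemma weightedIntegral_one (ha : -1 < a) (hb : -1 < b) :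
    weightedIntegral a b 1 = jacobiGamma a b 0 := by
  have h := integral_beta_interval (u := b + 1) (v := a + 1) (c := -1) (d := 1)
    (by linarith) (by linarith) (by norm_num)
  have e : weightedIntegral a b 1 =
      ∫ y in (-1 : ℝ)..1, (y - -1) ^ (b + 1 - 1) * (1 - y) ^ (a + 1 - 1) := by
    unfold weightedIntegral
    congr 1
    ext y
    simp only [eval_one, one_mul, jacobiWeight, add_sub_cancel_right, sub_neg_eq_add]
    rw [mul_comm, add_comm y]
  rw [e, h, jacobiGamma, if_pos rfl]
  rw [show (1 : ℝ) - -1 = 2 by norm_num, show b + 1 + (a + 1) - 1 = a + b + 1 by ring,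
    show b + 1 + (a + 1) = a + b + 2 by ring]
  ring

lemma weightedIntegral_succ_succ (a b : ℝ) (p : ℝ[X]) :
    weightedIntegral (a + 1) (b + 1) p = weightedIntegral a b ((1 - X ^ 2) * p) := by
  unfold weightedIntegral
  apply intervalIntegral.integral_congr_ae
  -- The weights factor pointwise only where `1 - x` and `1 + x` are positive, so the endpoint `1`
  -- is discarded as a null set.
  have : ∀ᵐ x : ℝ, x ≠ 1 := by simp [ae_iff, measure_singleton]
  filter_upwards [this] with x hx1 hx
  rw [uIoc_of_le (by norm_num)] at hx
  have h1 : 0 < 1 - x := by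
    have := lt_of_le_of_ne hx.2 hx1
    linarith
  have h2 : 0 < 1 + x := by linarith [hx.1]
  simp only [jacobiWeight, Real.rpow_add h1, Real.rpow_add h2, Real.rpow_one, eval_mul, eval_sub,
    eval_one, eval_pow, eval_X]
  ring

/-- Integration by parts against the Jacobi weight. -/
lemma weightedIntegral_derivative (ha : -1 < a) (hb : -1 < b) (r : ℝ[X]) :
    weightedIntegral a b
      ((1 - X ^ 2) * derivative r + (C (b - a) - C (a + b + 2) * X) * r) = 0 := by
  have key := intervalIntegral.integral_eq_sub_of_hasDerivAt_of_le (a := -1) (b := 1)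
    (f := fun x => r.eval x * ((1 - x) ^ (a + 1) * (1 + x) ^ (b + 1)))
    (f' := fun x => ((1 - X ^ 2) * derivative r + (C (b - a) - C (a + b + 2) * X) * r).eval x *
      jacobiWeight a b x) (by norm_num) ?_ ?_ ?_
  · rw [weightedIntegral, key]
    simp [Real.zero_rpow (by linarith : a + 1 ≠ 0), Real.zero_rpow (by linarith : b + 1 ≠ 0)]
  · apply ContinuousOn.mul r.continuous.continuousOn
    apply ContinuousOn.mul
    · exact (continuousOn_const.sub continuousOn_id).rpow_const fun x _ => Or.inr (by linarith)
    · exact (continuousOn_const.add continuousOn_id).rpow_const fun x _ => Or.inr (by linarith)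
  · intro x hx
    have h1 : 0 < 1 - x := by linarith [hx.2]
    have h2 : 0 < 1 + x := by linarith [hx.1]
    have d1 : HasDerivAt (fun x : ℝ => (1 - x) ^ (a + 1)) (-1 * (a + 1) * (1 - x) ^ (a + 1 - 1)) x :=
      ((hasDerivAt_id x).const_sub 1).rpow_const (Or.inl h1.ne')
    have d2 : HasDerivAt (fun x : ℝ => (1 + x) ^ (b + 1)) (1 * (b + 1) * (1 + x) ^ (b + 1 - 1)) x :=
      ((hasDerivAt_id x).const_add 1).rpow_const (Or.inl h2.ne')
    have := (r.hasDerivAt x).mul (d1.mul d2)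
    refine this.congr_deriv ?_
    simp only [jacobiWeight, Real.rpow_add h1, Real.rpow_add h2, Real.rpow_one, eval_mul, eval_sub,
      eval_one, eval_pow, eval_X, eval_add, eval_C, add_sub_cancel_right, Pi.mul_apply]
    ring
  · exact intervalIntegrable_eval_mul_jacobiWeight ha hb _

/-- The Jacobi operator in divergence form. -/
lemma weightedIntegral_derivative_jacobi (ha : -1 < a) (hb : -1 < b) (n : ℕ) (q : ℝ[X]) :
    weightedIntegral (a + 1) (b + 1) (derivative (jacobi a b n) * derivative q) =
      n * (n + a + b + 1) * weightedIntegral a b (jacobi a b n * q) := by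
  have h := weightedIntegral_derivative ha hb (derivative (jacobi a b n) * q)
  have e : (1 - X ^ 2) * derivative (derivative (jacobi a b n) * q) +
      (C (b - a) - C (a + b + 2) * X) * (derivative (jacobi a b n) * q) =
      (1 - X ^ 2) * (derivative (jacobi a b n) * derivative q) +
      C (-(n * (n + a + b + 1))) * (jacobi a b n * q) := by
    rw [derivative_mul, C_neg]
    linear_combination q * jacobi_ode a b n
  rw [e, weightedIntegral_add ha hb, weightedIntegral_C_mul, ← weightedIntegral_succ_succ] at h
  linarith

lemma natDegree_le_of_degree_lt_succ {p : ℝ[X]} {n : ℕ} (h : p.degree < ((n + 1 : ℕ) : WithBot ℕ)) :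
    p.natDegree ≤ n := by
  rw [natDegree_le_iff_coeff_eq_zero]
  intro k hk
  exact (degree_lt_iff_coeff_zero _ _).mp h k hk

/-- Induction through the divergence form: differentiation lowers the index and the degree of `q` by
one and raises both parameters by one, and the eigenvalue on the other side is nonzero. The
parameters are therefore quantified inside the induction. -/
lemma weightedIntegral_jacobi_mul_eq_zero (n : ℕ) : ∀ {a b : ℝ}, -1 < a → -1 < b →
    ∀ q : ℝ[X], q.degree < n → weightedIntegral a b (jacobi a b n * q) = 0 := by
  induction n with
  | zero =>
    intro a b _ _ q hq
    have : q = 0 := by simpa using hq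
    simp [this, weightedIntegral_zero]
  | succ n ih =>
    intro a b ha hb q hq
    have h := weightedIntegral_derivative_jacobi ha hb (n + 1) q
    have hq' : (derivative q).degree < n := by
      by_cases h0 : q = 0
      · simp [h0]
      · have h1 := degree_derivative_lt h0
        exact lt_of_lt_of_le h1 (degree_le_of_natDegree_le (natDegree_le_of_degree_lt_succ hq))
    rw [derivative_jacobi, mul_assoc, weightedIntegral_C_mul,
      ih (by linarith) (by linarith) _ hq', mul_zero] at h
    have hn : (0 : ℝ) ≤ n := n.cast_nonneg
    have : ((n + 1 : ℕ) : ℝ) * ((n + 1 : ℕ) + a + b + 1) ≠ 0 := by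
      push_cast
      exact (mul_pos (by linarith) (by linarith)).ne'
    exact (mul_eq_zero.mp h.symm).resolve_left this

lemma jacobi_zero (a b : ℝ) : jacobi a b 0 = 1 := by simp [jacobi]

lemma jacobiGamma_pos (ha : -1 < a) (hb : -1 < b) (n : ℕ) : 0 < jacobiGamma a b n := by
  unfold jacobiGamma
  have h2 : (0 : ℝ) < 2 ^ (a + b + 1) := Real.rpow_pos_of_pos (by norm_num) _
  split_ifs with h
  · have := Real.Gamma_pos_of_pos (by linarith : 0 < a + 1)
    have := Real.Gamma_pos_of_pos (by linarith : 0 < b + 1)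
    have := Real.Gamma_pos_of_pos (by linarith : 0 < a + b + 2)
    positivity
  · have h1 : (1 : ℝ) ≤ n := by exact_mod_cast Nat.one_le_iff_ne_zero.mpr h
    have := Real.Gamma_pos_of_pos (by linarith : 0 < n + a + 1)
    have := Real.Gamma_pos_of_pos (by linarith : 0 < n + b + 1)
    have := Real.Gamma_pos_of_pos (by linarith : 0 < n + a + b + 1)
    have : 0 < 2 * n + a + b + 1 := by linarith
    have := Nat.factorial_pos n
    positivity

/-- The recursion that drives the induction for the norms in `weightedIntegral_jacobi_sq`. -/
lemma jacobiGamma_succ (ha : -1 < a) (hb : -1 < b) (n : ℕ) :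
    jacobiGamma a b (n + 1) * (4 * (n + 1)) =
      (n + a + b + 2) * jacobiGamma (a + 1) (b + 1) n := by
  have e2 : (2 : ℝ) ^ (a + 1 + (b + 1) + 1) = 2 ^ (a + b + 1) * 4 := by
    rw [show a + 1 + (b + 1) + 1 = (a + b + 1) + 2 by ring, Real.rpow_add (by norm_num)]
    norm_num
  rcases n with _ | n
  · simp only [jacobiGamma, e2]
    norm_num
    have g1 := Real.Gamma_add_one (s := a + b + 2) (by linarith)
    have g2 := Real.Gamma_add_one (s := a + b + 2 + 1) (by linarith)
    rw [show a + 1 + (b + 1) + 2 = a + b + 2 + 1 + 1 by ring, g2, g1,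
      show 1 + a + 1 = a + 1 + 1 by ring, show 1 + b + 1 = b + 1 + 1 by ring,
      show 1 + a + b + 1 = a + b + 2 by ring]
    have := (Real.Gamma_pos_of_pos (by linarith : 0 < a + b + 2)).ne'
    have : a + b + 2 ≠ 0 := by linarith
    have : a + b + 2 + 1 ≠ 0 := by linarith
    have : 2 + a + b + 1 ≠ 0 := by linarith
    field_simp
    ring
  · have hn : (0 : ℝ) ≤ n := n.cast_nonneg
    simp only [jacobiGamma, e2, Nat.succ_ne_zero, if_false]
    push_cast
    have g1 := Real.Gamma_add_one (s := n + a + b + 3) (by linarith)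
    rw [show (n : ℝ) + 1 + (a + 1) + (b + 1) + 1 = n + a + b + 3 + 1 by ring, g1,
      show (n : ℝ) + 1 + (a + 1) + 1 = n + 1 + 1 + a + 1 by ring,
      show (n : ℝ) + 1 + (b + 1) + 1 = n + 1 + 1 + b + 1 by ring,
      show (n : ℝ) + 1 + 1 + a + b + 1 = n + a + b + 3 by ring, Nat.factorial_succ (n + 1)]
    push_cast
    have := (Real.Gamma_pos_of_pos (by linarith : 0 < n + a + b + 3)).ne'
    have : (n : ℝ) + a + b + 3 ≠ 0 := by linarith
    have := Nat.factorial_ne_zero (n + 1)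
    have : 2 * ((n : ℝ) + 1 + 1) + a + b + 1 ≠ 0 := by linarith
    have : 2 * ((n : ℝ) + 1) + (a + 1) + (b + 1) + 1 ≠ 0 := by linarith
    field_simp
    ring

lemma weightedIntegral_jacobi_sq (n : ℕ) : ∀ {a b : ℝ}, -1 < a → -1 < b →
    weightedIntegral a b (jacobi a b n * jacobi a b n) = jacobiGamma a b n := by
  induction n with
  | zero => intro a b ha hb; rw [jacobi_zero, one_mul, weightedIntegral_one ha hb]
  | succ n ih =>
    intro a b ha hb
    have h := weightedIntegral_derivative_jacobi ha hb (n + 1) (jacobi a b (n + 1))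
    rw [derivative_jacobi, mul_assoc, mul_left_comm (jacobi _ _ _), weightedIntegral_C_mul,
      weightedIntegral_C_mul, ih (by linarith) (by linarith)] at h
    have hg := jacobiGamma_succ ha hb n
    have hn : (0 : ℝ) ≤ n := n.cast_nonneg
    have h1 : (n : ℝ) + a + b + 2 ≠ 0 := by linarith
    have h2 : (n : ℝ) + 1 ≠ 0 := by linarith
    push_cast at h
    have h3 : ((n : ℝ) + 1) * (n + a + b + 2) ≠ 0 := mul_ne_zero h2 h1
    apply mul_left_cancel₀ h3
    linear_combination (n + a + b + 2) / 4 * hg * (-1) - h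

lemma weightedIntegral_jacobi_mul_jacobi (ha : -1 < a) (hb : -1 < b) (m n : ℕ) :
    weightedIntegral a b (jacobi a b m * jacobi a b n) =
      if m = n then jacobiGamma a b n else 0 := by
  have hdeg : ∀ {k l : ℕ}, k < l → (jacobi a b k).degree < l := fun {k l} h =>
    lt_of_le_of_lt (degree_le_of_natDegree_le (natDegree_jacobi_le a b k)) (by exact_mod_cast h)
  split_ifs with h
  · rw [h, weightedIntegral_jacobi_sq n ha hb]
  · rcases lt_or_gt_of_ne h with h | h
    · rw [mul_comm]; exact weightedIntegral_jacobi_mul_eq_zero n ha hb _ (hdeg h)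
    · exact weightedIntegral_jacobi_mul_eq_zero m ha hb _ (hdeg h)

/-- Leading terms are stripped one by one, which is possible because the leading coefficients do not
vanish. -/
lemma exists_sum_jacobi (ha : -1 < a) (hb : -1 < b) (N : ℕ) : ∀ p : ℝ[X], p.degree < N →
    ∃ e : ℕ → ℝ, p = ∑ n ∈ Finset.range N, C (e n) * jacobi a b n := by
  induction N with
  | zero => intro p hp; exact ⟨0, by simpa using hp⟩
  | succ N ih =>
    intro p hp
    have hne := coeff_jacobi_self_ne_zero ha hb N
    set c := p.coeff N / (jacobi a b N).coeff N
    have hlt : (p - C c * jacobi a b N).degree < N := by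
      apply natDegree_sub_lt_of_coeff_eq
      · exact natDegree_le_of_degree_lt_succ hp
      · exact (natDegree_C_mul_le _ _).trans (natDegree_jacobi_le a b N)
      · rw [coeff_C_mul, div_mul_cancel₀ _ hne]
    obtain ⟨e, he⟩ := ih _ hlt
    refine ⟨fun n => if n = N then c else e n, ?_⟩
    simp only [Finset.sum_range_succ, if_true]
    rw [← sub_eq_iff_eq_add, he]
    apply Finset.sum_congr rfl
    intro n hn
    rw [if_neg (Finset.mem_range.mp hn).ne]

/-- The Jacobi expansion of a polynomial. -/
lemma eq_sum_jacobi (ha : -1 < a) (hb : -1 < b) {N : ℕ} {p : ℝ[X]} (hp : p.degree < N) :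
    p = ∑ n ∈ Finset.range N,
      C (1 / jacobiGamma a b n * weightedIntegral a b (jacobi a b n * p)) * jacobi a b n := by
  obtain ⟨e, he⟩ := exists_sum_jacobi ha hb N p hp
  conv_lhs => rw [he]
  apply Finset.sum_congr rfl
  intro n hn
  have : weightedIntegral a b (jacobi a b n * p) = e n * jacobiGamma a b n := by
    rw [he, Finset.mul_sum, weightedIntegral_sum ha hb, Finset.sum_eq_single n]
    · rw [mul_left_comm, weightedIntegral_C_mul, weightedIntegral_jacobi_mul_jacobi ha hb,
        if_pos rfl]
    · intro k _ hk
      rw [mul_left_comm, weightedIntegral_C_mul, weightedIntegral_jacobi_mul_jacobi ha hb,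
        if_neg hk.symm, mul_zero]
    · intro h; exact absurd hn h
  rw [this, mul_comm (e n), ← mul_assoc, one_div_mul_cancel (jacobiGamma_pos ha hb n).ne', one_mul]

end

/-! ### Gauss–Lobatto quadrature and the cardinal polynomials. -/

section

variable {α β : ℝ} {N : ℕ} {x : Fin (N + 1) → ℝ}

lemma natDegree_derivative_jacobi (hα : -1 < α) (hβ : -1 < β) (N : ℕ) :
    (derivative (jacobi α β N)).natDegree = N - 1 := by
  have h : (jacobi α β N).natDegree = N :=
    natDegree_eq_of_le_of_coeff_ne_zero (natDegree_jacobi_le α β N)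
      (coeff_jacobi_self_ne_zero hα hβ N)
  rw [natDegree_derivative, h]

lemma derivative_jacobi_ne_zero (hN : 1 ≤ N) (hα : -1 < α) (hβ : -1 < β) :
    derivative (jacobi α β N) ≠ 0 := by
  intro h
  have h1 := congrArg (fun p => p.coeff (N - 1)) h
  simp only [coeff_derivative, coeff_zero] at h1
  obtain ⟨M, rfl⟩ : ∃ M, N = M + 1 := ⟨N - 1, by omega⟩
  rw [Nat.add_sub_cancel] at h1
  have h2 := coeff_jacobi_self_ne_zero hα hβ (M + 1)
  have h3 : (M : ℝ) + 1 ≠ 0 := by positivity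
  exact (mul_ne_zero h2 h3) h1

lemma IsJGLNodes.neg_one_lt (hx : IsJGLNodes α β N x) {i : Fin (N + 1)} (hi : i ≠ 0) :
    -1 < x i := by
  rw [← hx.first]; exact hx.strictMono (Fin.pos_iff_ne_zero.mpr hi)

lemma IsJGLNodes.lt_one (hx : IsJGLNodes α β N x) {i : Fin (N + 1)} (hi : i ≠ Fin.last N) :
    x i < 1 := by
  rw [← hx.last]; exact hx.strictMono (Fin.lt_last_iff_ne_last.mpr hi)

lemma IsJGLNodes.eval_derivative (hx : IsJGLNodes α β N x) {i : Fin (N + 1)} (hi : i ≠ 0)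
    (hi' : i ≠ Fin.last N) : (derivative (jacobi α β N)).eval (x i) = 0 := by
  have h := (hx.zeros (x i)).mpr ⟨i, rfl⟩
  simp only [IsRoot.def, eval_mul, eval_sub, eval_one, eval_pow, eval_X] at h
  have h1 := hx.neg_one_lt hi
  have h2 := hx.lt_one hi'
  rcases mul_eq_zero.mp h with h | h
  · nlinarith
  · exact h

/-- The quadrature rule at the Jacobi-Gauss-Lobatto nodes is exact in degree less than `2N`. -/
lemma IsJGLNodes.weightedIntegral_eq_sum (hx : IsJGLNodes α β N x) (hN : 1 ≤ N) (hα : -1 < α)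
    (hβ : -1 < β) {f : ℝ[X]} (hf : f.natDegree < 2 * N) :
    weightedIntegral α β f = ∑ i, f.eval (x i) * quadWeight α β x i := by
  obtain ⟨M, rfl⟩ : ∃ M, N = M + 1 := ⟨N - 1, by omega⟩
  set W : ℝ[X] := (1 - X ^ 2) * derivative (jacobi α β (M + 1)) with hW
  have hX : (1 - X ^ 2 : ℝ[X]) = -(X ^ 2 - C 1) := by simp
  have hX2 : (1 - X ^ 2 : ℝ[X]).natDegree = 2 := by
    rw [hX, natDegree_neg, natDegree_X_pow_sub_C]
  have hX0 : (1 - X ^ 2 : ℝ[X]) ≠ 0 := by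
    intro h; rw [h] at hX2; simp at hX2
  have hD0 := derivative_jacobi_ne_zero (N := M + 1) (by omega) hα hβ
  have hW0 : W ≠ 0 := mul_ne_zero hX0 hD0
  have hWdeg : W.natDegree = M + 2 := by
    rw [hW, natDegree_mul hX0 hD0, hX2, natDegree_derivative_jacobi hα hβ]; omega
  have hsplit : f = W * (f / W) + f % W := (EuclideanDomain.div_add_mod f W).symm
  have hroot : ∀ i, W.eval (x i) = 0 := fun i => (hx.zeros (x i)).mpr ⟨i, rfl⟩
  have hrdeg : (f % W).degree < (Finset.univ : Finset (Fin (M + 1 + 1))).card := by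
    rw [Finset.card_univ, Fintype.card_fin]
    have := EuclideanDomain.mod_lt f hW0
    refine lt_of_lt_of_le (show (f % W).degree < W.degree from this) ?_
    rw [degree_eq_natDegree hW0, hWdeg]
  -- The factor `1 - X²` of `W` turns the weight into that of `(α+1, β+1)`, for which `P_N'`, a
  -- multiple of `P_M^{(α+1,β+1)}`, is orthogonal to the quotient. The quotient has degree less than
  -- `M`, since `deg f < 2M + 2` and `deg W = M + 2`.
  have hq : weightedIntegral α β (W * (f / W)) = 0 := by
    suffices h : (f / W).degree < M by
      generalize f / W = q at *
      rw [hW, mul_assoc, ← weightedIntegral_succ_succ, derivative_jacobi, mul_assoc,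
        weightedIntegral_C_mul, weightedIntegral_jacobi_mul_eq_zero M (by linarith) (by linarith)
          q h, mul_zero]
    by_cases h0 : f / W = 0
    · rw [h0, degree_zero]; exact WithBot.bot_lt_coe M
    · have hle : W.degree ≤ f.degree := by
        by_contra hc
        exact h0 ((Polynomial.div_eq_zero_iff hW0).mpr (not_le.mp hc))
      have hf0 : f ≠ 0 := by rintro rfl; simp at h0
      have h := degree_add_div hW0 hle
      rw [degree_eq_natDegree hW0, degree_eq_natDegree h0, degree_eq_natDegree hf0, hWdeg] at h
      rw [← natDegree_lt_iff_degree_lt h0]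
      have h' : M + 2 + (f / W).natDegree = f.natDegree := by exact_mod_cast h
      omega
  have hr := Lagrange.eq_interpolate (hx.strictMono.injective.injOn) hrdeg
  rw [Lagrange.interpolate_apply] at hr
  have hL : weightedIntegral α β (f % W) = ∑ i, f.eval (x i) * quadWeight α β x i := by
    rw [hr, weightedIntegral_sum hα hβ]
    apply Finset.sum_congr rfl
    intro i _
    rw [weightedIntegral_C_mul]
    have : (f % W).eval (x i) = f.eval (x i) := by
      conv_rhs => rw [hsplit, eval_add, eval_mul, hroot, zero_mul, zero_add]
    rw [this]; rfl
  rw [← hL]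
  conv_lhs => rw [hsplit, weightedIntegral_add hα hβ, hq, zero_add]

/-- The cardinal polynomials at all nodes but the last. -/
def cardinal (x : Fin (N + 1) → ℝ) (j : Fin (N + 1)) : ℝ[X] :=
  Lagrange.basis (Finset.univ.erase (Fin.last N)) x j

lemma eval_cardinal (hx : Function.Injective x) {i j : Fin (N + 1)} (hi : i ≠ Fin.last N)
    (hj : j ≠ Fin.last N) : (cardinal x j).eval (x i) = if i = j then 1 else 0 := by
  split_ifs with h
  · rw [h]; exact Lagrange.eval_basis_self hx.injOn (by simp [hj])
  · exact Lagrange.eval_basis_of_ne (Ne.symm h) (by simp [hi])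

lemma degree_cardinal_lt (hx : Function.Injective x) {j : Fin (N + 1)} (hN : 1 ≤ N)
    (hj : j ≠ Fin.last N) : (cardinal x j).degree < N := by
  rw [cardinal, Lagrange.degree_basis hx.injOn (by simp [hj]), Finset.card_erase_of_mem (by simp),
    Finset.card_univ, Fintype.card_fin, Nat.cast_lt]
  omega

lemma eq_of_eval_eq_of_degree_lt (hx : Function.Injective x) {p q : ℝ[X]} (hp : p.degree < N)
    (hq : q.degree < N) (h : ∀ i, i ≠ Fin.last N → p.eval (x i) = q.eval (x i)) : p = q := by
  have hc : (Finset.univ.erase (Fin.last N)).card = N := by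
    rw [Finset.card_erase_of_mem (by simp), Finset.card_univ, Fintype.card_fin, Nat.add_sub_cancel]
  refine Polynomial.eq_of_degrees_lt_of_eval_index_eq (s := Finset.univ.erase (Fin.last N)) (v := x)
    hx.injOn (by rwa [hc]) (by rwa [hc]) fun i hi => h i (by simpa using hi)

lemma degree_derivative_jacobi_lt (hN : 1 ≤ N) (hα : -1 < α) (hβ : -1 < β) :
    (derivative (jacobi α β N)).degree < N := by
  apply lt_of_le_of_lt degree_le_natDegree
  rw [natDegree_derivative_jacobi hα hβ, Nat.cast_lt]
  omega

lemma last_ne_zero (hN : 1 ≤ N) : (0 : Fin (N + 1)) ≠ Fin.last N := by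
  intro h; have := congrArg Fin.val h; simp at this; omega

lemma degree_const_mul_le (c : ℝ) (p : ℝ[X]) : (C c * p).degree ≤ p.degree := by
  rw [← smul_eq_C_mul]; exact degree_smul_le c p

/-- `P_N'` has degree `N - 1` and vanishes at the interior nodes, so only its value at `-1` is free.
-/
lemma IsJGLNodes.derivative_eq (hx : IsJGLNodes α β N x) (hN : 1 ≤ N) (hα : -1 < α)
    (hβ : -1 < β) : derivative (jacobi α β N) =
      C ((derivative (jacobi α β N)).eval (-1)) * cardinal x 0 := by
  have hinj := hx.strictMono.injective
  have h0 := last_ne_zero hN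
  apply eq_of_eval_eq_of_degree_lt hinj (degree_derivative_jacobi_lt hN hα hβ)
  · exact lt_of_le_of_lt (degree_const_mul_le _ _) (degree_cardinal_lt hinj hN h0)
  · intro i hi
    rw [eval_mul, eval_C, eval_cardinal hinj hi h0]
    split_ifs with h
    · rw [h, hx.first, mul_one]
    · rw [mul_zero, hx.eval_derivative h hi]

lemma eval_jacobi_ode (α β : ℝ) (N : ℕ) (y : ℝ) :
    (1 - y ^ 2) * (derivative (derivative (jacobi α β N))).eval y
      + (β - α - (α + β + 2) * y) * (derivative (jacobi α β N)).eval y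
      + N * (N + α + β + 1) * (jacobi α β N).eval y = 0 := by
  have := congrArg (fun p => p.eval y) (jacobi_ode α β N)
  simpa using this

lemma eigenvalue_pos (hN : 1 ≤ N) (hα : -1 < α) (hβ : -1 < β) :
    0 < (N : ℝ) * (N + α + β + 1) := by
  have : (1 : ℝ) ≤ N := by exact_mod_cast hN
  exact mul_pos (by linarith) (by linarith)

/-- By `IsJGLNodes.derivative_eq` the value is `P_N'(1)/P_N'(-1)`. At `±1` the second-order term of
the Jacobi equation drops out, which expresses both derivatives through `P_N(±1)`. -/
lemma IsJGLNodes.eval_one_cardinal_zero (hx : IsJGLNodes α β N x) (hN : 1 ≤ N) (hα : -1 < α)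
    (hβ : -1 < β) : (cardinal x 0).eval 1 =
      -((β + 1) / (α + 1) * ((jacobi α β N).eval 1 / (jacobi α β N).eval (-1))) := by
  have hD := hx.derivative_eq hN hα hβ
  have hD0 := derivative_jacobi_ne_zero hN hα hβ
  have hm : (derivative (jacobi α β N)).eval (-1) ≠ 0 := by
    intro h; rw [h, C_0, zero_mul] at hD; exact hD0 hD
  have h1 := congrArg (fun p => p.eval 1) hD
  simp only [eval_mul, eval_C] at h1
  have o1 := eval_jacobi_ode α β N 1
  have o2 := eval_jacobi_ode α β N (-1)
  have hl := eigenvalue_pos hN hα hβ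
  rw [h1] at o1
  generalize (derivative (jacobi α β N)).eval (-1) = d at *
  generalize (N : ℝ) * (N + α + β + 1) = l at *
  generalize (jacobi α β N).eval (-1) = pm at *
  have ha : α + 1 ≠ 0 := by linarith
  have hb : β + 1 ≠ 0 := by linarith
  have hpm : pm ≠ 0 := by
    rintro rfl
    have : (β + 1) * d = 0 := by linarith
    exact (mul_ne_zero hb hm) this
  field_simp
  apply mul_left_cancel₀ (mul_ne_zero hl.ne' hm)
  linear_combination (-pm * l / 2) * o1 + (1 / 2) * l * eval 1 (jacobi α β N) * o2

/-- The cardinal polynomial is proportional to `E = (1+x) P_N'/(x - x_j)`. Here `E(x_j) = (1+x_j)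
P_N''(x_j)` and `(1-x_j) E(1) = 2 P_N'(1)`; the Jacobi equation at `x_j` and at `1` turns these into
values of `P_N`. -/
lemma IsJGLNodes.eval_one_cardinal (hx : IsJGLNodes α β N x) (hN : 1 ≤ N) (hα : -1 < α)
    (hβ : -1 < β) {j : Fin (N + 1)} (hj : j ≠ 0) (hj' : j ≠ Fin.last N) :
    (cardinal x j).eval 1 =
      -(1 / (α + 1) * ((jacobi α β N).eval 1 / (jacobi α β N).eval (x j))) := by
  have hinj := hx.strictMono.injective
  have hD0 := derivative_jacobi_ne_zero hN hα hβ
  have hx1 : (1 + X : ℝ[X]) = X + C 1 := by simp [add_comm]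
  have hroot : ((1 + X) * derivative (jacobi α β N)).IsRoot (x j) := by
    simp [hx.eval_derivative hj hj']
  obtain ⟨E, hE⟩ := dvd_iff_isRoot.mpr hroot
  have hne : (1 + X) * derivative (jacobi α β N) ≠ 0 :=
    mul_ne_zero (by rw [hx1]; exact X_add_C_ne_zero 1) hD0
  have hE0 : E ≠ 0 := by rintro rfl; rw [mul_zero] at hE; exact hne hE
  have hEdeg : E.degree < N := by
    rw [← natDegree_lt_iff_degree_lt hE0]
    have h := congrArg natDegree hE
    rw [natDegree_mul (X_sub_C_ne_zero _) hE0, natDegree_X_sub_C, natDegree_mul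
      (by rw [hx1]; exact X_add_C_ne_zero 1) hD0, hx1, natDegree_X_add_C,
      natDegree_derivative_jacobi hα hβ] at h
    omega
  have hEv : E = C (E.eval (x j)) * cardinal x j := by
    apply eq_of_eval_eq_of_degree_lt hinj hEdeg
    · exact lt_of_le_of_lt (degree_const_mul_le _ _) (degree_cardinal_lt hinj hN hj')
    · intro i hi
      rw [eval_mul, eval_C, eval_cardinal hinj hi hj']
      split_ifs with h
      · rw [h, mul_one]
      · have h1 := congrArg (fun p => p.eval (x i)) hE
        simp only [eval_mul, eval_add, eval_one, eval_X, eval_sub, eval_C] at h1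
        have h2 : (1 + x i) * (derivative (jacobi α β N)).eval (x i) = 0 := by
          by_cases h0 : i = 0
          · rw [h0, hx.first]; simp
          · rw [hx.eval_derivative h0 hi, mul_zero]
        rw [h2] at h1
        rw [mul_zero]
        exact (mul_eq_zero.mp h1.symm).resolve_left (sub_ne_zero.mpr fun h' => h (hinj h'))
  have hκ : E.eval (x j) ≠ 0 := by
    intro h; rw [h, C_0, zero_mul] at hEv; exact hE0 hEv
  have e1 := congrArg (fun p => p.eval 1) hE
  have e2 := congrArg (fun p => (derivative p).eval (x j)) hE
  simp only [derivative_mul, eval_mul, eval_add, eval_one, eval_X, eval_sub, eval_C, derivative_add,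
    derivative_one, derivative_X, derivative_sub, derivative_C, hx.eval_derivative hj hj',
    sub_self, eval_zero] at e1 e2
  have e3 := congrArg (fun p => p.eval 1) hEv
  simp only [eval_mul, eval_C] at e3
  rw [e3] at e1
  have o1 := eval_jacobi_ode α β N 1
  have o2 := eval_jacobi_ode α β N (x j)
  rw [hx.eval_derivative hj hj'] at o2
  have hl := eigenvalue_pos hN hα hβ
  generalize (N : ℝ) * (N + α + β + 1) = l at *
  generalize (derivative (derivative (jacobi α β N))).eval (x j) = d2 at *
  generalize (derivative (jacobi α β N)).eval 1 = d at *
  generalize E.eval (x j) = κ at *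
  have ha : α + 1 ≠ 0 := by linarith
  have hxj : 1 - x j ≠ 0 := by linarith [hx.lt_one hj']
  have e2' : κ = (1 + x j) * d2 := by linarith
  have hpj : (jacobi α β N).eval (x j) ≠ 0 := by
    intro h
    rw [h] at o2
    have : (1 - x j) * κ = 0 := by rw [e2']; linarith
    exact (mul_ne_zero hxj hκ) this
  field_simp
  apply mul_left_cancel₀ hl.ne'
  rw [e2'] at e1
  linear_combination (α + 1) * (cardinal x j).eval 1 * o2 + o1 + (α + 1) * e1

/-- The Jacobi coefficients are computed exactly by quadrature, the products having degree at most
`2N - 2`. Only the nodes `x_j` and `x_N = 1` contribute; the latter gives the correction with `ω_N`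
in `rho`. -/
lemma IsJGLNodes.cardinal_eq_sum (hx : IsJGLNodes α β N x) (hN : 1 ≤ N) (hα : -1 < α)
    (hβ : -1 < β) {j : Fin (N + 1)} (hj : j ≠ Fin.last N) :
    cardinal x j = ∑ n ∈ Finset.range N, C (rho α β x n j) * jacobi α β n := by
  have hinj := hx.strictMono.injective
  have hdeg := degree_cardinal_lt hinj hN hj
  refine (eq_sum_jacobi hα hβ hdeg).trans (Finset.sum_congr rfl fun n hn => ?_)
  congr 2
  have hn' := Finset.mem_range.mp hn
  have hnat : (cardinal x j).natDegree ≤ N - 1 := by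
    apply natDegree_le_of_degree_lt_succ
    rwa [Nat.sub_add_cancel hN]
  rw [hx.weightedIntegral_eq_sum hN hα hβ]
  · rw [← Finset.sum_erase_add _ _ (Finset.mem_univ (Fin.last N)),
      Finset.sum_eq_single_of_mem j (by simp [hj])]
    · rw [hx.last, eval_mul, eval_mul, eval_cardinal hinj hj hj, if_pos rfl, mul_one]
      unfold rho
      split_ifs with h
      · subst h
        rw [hx.eval_one_cardinal_zero hN hα hβ, hx.first]
        ring
      · rw [hx.eval_one_cardinal hN hα hβ h hj]
        ring
    · intro i hi hij
      rw [eval_mul, eval_cardinal hinj (by simpa using hi) hj, if_neg hij]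
      simp
  · have := natDegree_mul_le (p := jacobi α β n) (q := cardinal x j)
    have := natDegree_jacobi_le α β n
    omega

lemma jacobi_eq_sum_connCoeff (α β : ℝ) {a b : ℝ} (ha : -1 < a) (hb : -1 < b) (n : ℕ) :
    jacobi α β n = ∑ l ∈ Finset.range (n + 1), C (connCoeff α β a b l n) * jacobi a b l := by
  have hdeg : (jacobi α β n).degree < (n + 1 : ℕ) :=
    lt_of_le_of_lt (degree_le_of_natDegree_le (natDegree_jacobi_le α β n))
      (by exact_mod_cast Nat.lt_succ_self n)
  refine (eq_sum_jacobi ha hb hdeg).trans (Finset.sum_congr rfl fun l _ => ?_)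
  simp [connCoeff, weightedIntegral]

lemma IsJGLNodes.cardinal_eq_sum_rhoTilde (hx : IsJGLNodes α β N x) (hN : 1 ≤ N) (hα : -1 < α)
    (hβ : -1 < β) {μ : ℝ} (hμ₁ : 1 < μ) (hμ₂ : μ < 2) {j : Fin (N + 1)} (hj : j ≠ Fin.last N) :
    cardinal x j =
      ∑ l ∈ Finset.range N, C (rhoTilde α β μ x l j) * jacobi μ (1 - μ) l := by
  rw [hx.cardinal_eq_sum hN hα hβ hj]
  simp only [rhoTilde, map_sum, Finset.sum_mul]
  rw [Finset.sum_comm' (t' := Finset.range N) (s' := fun n => Finset.range (n + 1))]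
  · apply Finset.sum_congr rfl
    intro n _
    conv_lhs => rw [jacobi_eq_sum_connCoeff α β (by linarith : -1 < μ) (by linarith : -1 < 1 - μ),
      Finset.mul_sum]
    apply Finset.sum_congr rfl
    intro l _
    rw [C_mul]; ring
  · intro l n
    simp only [Finset.mem_range, Finset.mem_Ico]
    omega

end

/-! ### Three-term recurrence for `(μ, 1-μ)` and division by `1 + x`. -/

section

lemma ascPochhammer_mul_eval_add_one (k : ℕ) (y : ℝ) :
    y * (ascPochhammer ℝ k).eval (y + 1) = (ascPochhammer ℝ k).eval y * (y + k) := by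
  rw [← ascPochhammer_eval_succ_left, ascPochhammer_succ_eval]

/-- Coefficients are compared in `t`, where `x = 1 + 2t`. As the parameters sum to `1`, the first
Pochhammer symbols do not contain `μ`. -/
lemma shiftedJacobi_three_term (μ : ℝ) (n : ℕ) :
    (1 + C 2 * X) * shiftedJacobi μ (1 - μ) (n + 1) =
      C (recA (n + 2)) * shiftedJacobi μ (1 - μ) (n + 2)
        + C (recB μ (n + 1)) * shiftedJacobi μ (1 - μ) (n + 1)
        + C (recCPred μ (n + 1)) * shiftedJacobi μ (1 - μ) n := by
  ext k
  have hn : (0 : ℝ) ≤ n := n.cast_nonneg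
  rcases k with _ | j
  · simp only [add_mul, one_mul, mul_assoc, coeff_add, coeff_C_mul, coeff_shiftedJacobi,
      coeff_X_mul_zero, mul_zero, Nat.zero_le, if_true, jacobiCoeff, recA,
      recB, recCPred, Nat.succ_ne_zero, if_false, ascPochhammer_zero, eval_one, Nat.sub_zero,
      ascPochhammer_succ_eval, Nat.factorial_zero, Nat.factorial_succ]
    push_cast
    have := Nat.factorial_ne_zero n
    field_simp
    ring
  · simp only [add_mul, one_mul, mul_assoc, coeff_add, coeff_C_mul, coeff_shiftedJacobi,
      coeff_X_mul]
    -- The cases differ in which of the polynomials of index `n`, `n + 1`, `n + 2` reach the degrees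
    -- involved.
    rcases lt_trichotomy j (n + 1) with h | h | h
    · rcases (Nat.lt_succ_iff.mp h).eq_or_lt with rfl | h'
      · rw [if_pos (by omega), if_pos (by omega), if_pos (by omega), if_neg (by omega)]
        simp only [jacobiCoeff, recA, recB, Nat.sub_self, Nat.add_sub_cancel_left,
          show j + 2 - (j + 1) = 1 by omega, ascPochhammer_zero, eval_one, ascPochhammer_one,
          eval_X, Nat.factorial_succ, Nat.factorial_zero]
        have e1 := ascPochhammer_mul_eval_add_one (j + 1) ((j : ℝ) + 3)
        rw [ascPochhammer_succ_eval j ((j : ℝ) + 3)] at e1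
        push_cast at e1 ⊢
        rw [show (j : ℝ) + 1 + μ + (1 - μ) + 1 = j + 3 by ring,
          show (j : ℝ) + 2 + μ + (1 - μ) + 1 = j + 3 + 1 by ring]
        have e2 : eval ((j : ℝ) + 3 + 1) (ascPochhammer ℝ (j + 1)) =
            eval ((j : ℝ) + 3) (ascPochhammer ℝ j) * (j + 3 + j) * (j + 3 + (j + 1)) / (j + 3) := by
          field_simp; linarith
        rw [e2]
        simp only [ascPochhammer_succ_eval]
        have := Nat.factorial_ne_zero j
        field_simp
        ring
      · obtain ⟨m, rfl⟩ : ∃ m, n = j + 1 + m := ⟨n - j - 1, by omega⟩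
        rw [if_pos (by omega), if_pos (by omega), if_pos (by omega), if_pos (by omega)]
        simp only [jacobiCoeff, recA, recB, recCPred, Nat.succ_ne_zero, if_false,
          show j + 1 + m + 1 - (j + 1) = m + 1 by omega, show j + 1 + m + 1 - j = m + 2 by omega,
          show j + 1 + m + 2 - (j + 1) = m + 2 by omega, show j + 1 + m - (j + 1) = m by omega]
        have e1 := ascPochhammer_mul_eval_add_one (j + 1) ((j : ℝ) + m + 4)
        have e2 := ascPochhammer_eval_succ_left j ((j : ℝ) + m + 3)
        have e3 := ascPochhammer_eval_succ_left (m + 1) (μ + j + 1)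
        rw [ascPochhammer_succ_eval j ((j : ℝ) + m + 4)] at e1
        push_cast at e1 e3 ⊢
        rw [show (j : ℝ) + 1 + m + 1 + μ + (1 - μ) + 1 = j + m + 4 by ring,
          show (j : ℝ) + 1 + m + 2 + μ + (1 - μ) + 1 = j + m + 4 + 1 by ring,
          show (j : ℝ) + 1 + m + μ + (1 - μ) + 1 = j + m + 3 by ring, e2, e3,
          show μ + ((j : ℝ) + 1) + 1 = μ + j + 1 + 1 by ring,
          show (j : ℝ) + m + 3 + 1 = j + m + 4 by ring]
        have e4 : eval ((j : ℝ) + m + 4 + 1) (ascPochhammer ℝ (j + 1)) =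
            eval ((j : ℝ) + m + 4) (ascPochhammer ℝ j) * (j + m + 4 + j) * (j + m + 4 + (j + 1))
              / (j + m + 4) := by
          field_simp; linarith
        rw [e4]
        simp only [ascPochhammer_succ_eval, Nat.factorial_succ]
        push_cast
        have := Nat.factorial_ne_zero j
        have := Nat.factorial_ne_zero m
        field_simp
        ring
    · subst h
      rw [if_neg (by omega), if_pos (by omega), if_pos (by omega), if_neg (by omega)]
      simp only [jacobiCoeff, recA, Nat.sub_self, ascPochhammer_zero, eval_one,
        Nat.factorial_succ, Nat.factorial_zero]
      have e1 := ascPochhammer_mul_eval_add_one (n + 2) ((n : ℝ) + 3)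
      rw [ascPochhammer_succ_eval (n + 1) ((n : ℝ) + 3)] at e1
      push_cast at e1 ⊢
      rw [show (n : ℝ) + 1 + μ + (1 - μ) + 1 = n + 3 by ring,
        show (n : ℝ) + 2 + μ + (1 - μ) + 1 = n + 3 + 1 by ring]
      have e2 : eval ((n : ℝ) + 3 + 1) (ascPochhammer ℝ (n + 1 + 1)) =
          eval ((n : ℝ) + 3) (ascPochhammer ℝ (n + 1)) * (n + 3 + (n + 1)) * (n + 3 + (n + 2))
            / (n + 3) := by
        field_simp; linarith
      rw [e2]
      have := Nat.factorial_ne_zero n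
      field_simp
      ring
    · rw [if_neg (by omega), if_neg (by omega), if_neg (by omega), if_neg (by omega)]
      ring

/-- The three-term recurrence of the Jacobi polynomials with parameters `μ` and `1 - μ`. -/
lemma jacobi_three_term (μ : ℝ) (n : ℕ) :
    X * jacobi μ (1 - μ) n =
      C (recA (n + 1)) * jacobi μ (1 - μ) (n + 1) + C (recB μ n) * jacobi μ (1 - μ) n
        + C (recCPred μ n) * jacobi μ (1 - μ) (n - 1) := by
  have hC : (C (1 / 2 : ℝ)) * 2 = 1 := by
    rw [show (2 : ℝ[X]) = C 2 by rfl, ← C_mul]; norm_num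
  rcases n with _ | n
  · have h1 : jacobi μ (1 - μ) 1 = C (μ + 1) + C (3 / 2) * (X - 1) := by
      rw [jacobi, Finset.sum_range_succ, Finset.sum_range_one]
      have h3 : (C (3 / 2) : ℝ[X]) = 3 * C 2⁻¹ := by
        rw [show (3 : ℝ[X]) = C 3 by rfl, ← C_mul]; norm_num
      simp
      rw [h3]; ring
    rw [jacobi_zero, h1]
    simp only [recA, recB, recCPred, if_true, C_0, mul_one, add_zero, mul_add,
      ← mul_assoc, ← C_mul]
    norm_num
    rw [show (1 - 2 * μ) / 3 = 1 - 2 / 3 * (μ + 1) by ring]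
    simp only [C_sub, C_mul, C_add, C_1]
    ring
  · have h := congrArg (fun p => p.comp (C (1 / 2) * (X - 1))) (shiftedJacobi_three_term μ n)
    simp only [add_comp, mul_comp, C_comp, X_comp, one_comp, ← jacobi_eq_comp] at h
    rw [Nat.add_sub_cancel, ← h]
    have : (1 + C 2 * (C (1 / 2) * (X - 1)) : ℝ[X]) = X := by
      rw [show (C 2 : ℝ[X]) = 2 by rfl]; linear_combination (X - 1) * hC
    rw [this]

/-- Multiplication by `1 + x` is tridiagonal in this basis; the right-hand coefficients are the left
side of the backward recurrence. The zero extension of `H` absorbs the boundary terms. -/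
lemma one_add_X_mul_sum_jacobi (μ : ℝ) (M : ℕ) (H : ℕ → ℝ) (h0 : H 0 = 0)
    (hM : ∀ i, M < i → H i = 0) :
    (1 + X) * ∑ l ∈ Finset.range M, C (H (l + 1)) * jacobi μ (1 - μ) l =
      ∑ i ∈ Finset.range (M + 1),
        C (recA i * H i + (recB μ i + 1) * H (i + 1) + recCPred μ (i + 1) * H (i + 2)) *
          jacobi μ (1 - μ) i := by
  have s1 : ∑ i ∈ Finset.range (M + 1), C (recA i * H i) * jacobi μ (1 - μ) i =
      ∑ l ∈ Finset.range M, C (recA (l + 1) * H (l + 1)) * jacobi μ (1 - μ) (l + 1) := by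
    rw [Finset.sum_range_succ', h0]; simp
  have s2 : ∑ i ∈ Finset.range (M + 1), C ((recB μ i + 1) * H (i + 1)) * jacobi μ (1 - μ) i =
      ∑ l ∈ Finset.range M, C ((recB μ l + 1) * H (l + 1)) * jacobi μ (1 - μ) l := by
    rw [Finset.sum_range_succ, hM (M + 1) (by omega)]; simp
  have s3 : ∑ i ∈ Finset.range (M + 1), C (recCPred μ (i + 1) * H (i + 2)) * jacobi μ (1 - μ) i =
      ∑ l ∈ Finset.range M, C (recCPred μ l * H (l + 1)) * jacobi μ (1 - μ) (l - 1) := by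
    have := Finset.sum_range_succ' (fun l => C (recCPred μ l * H (l + 1)) * jacobi μ (1 - μ) (l - 1))
      (M + 1)
    simp only [Nat.add_sub_cancel] at this
    rw [show recCPred μ 0 = 0 by simp [recCPred], zero_mul, C_0, zero_mul, add_zero] at this
    rw [← this, Finset.sum_range_succ, Finset.sum_range_succ, hM (M + 1) (by omega),
      hM (M + 1 + 1) (by omega)]
    simp
  simp only [C_add, add_mul (C _ + C _), add_mul (C _) (C _) (jacobi _ _ _),
    Finset.sum_add_distrib] at *
  rw [s1, s2, s3, ← Finset.sum_add_distrib, ← Finset.sum_add_distrib, Finset.mul_sum]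
  apply Finset.sum_congr rfl
  intro l _
  have := jacobi_three_term μ l
  simp only [C_mul, C_add, C_1]
  linear_combination C (H (l + 1)) * this

/-- The entry of the backward recurrence with index `i`, extended by zero. -/
def backEntry (μ : ℝ) (t : ℕ → ℝ) (M i : ℕ) : ℝ :=
  if i = 0 then 0 else if i ≤ M then backSolve μ t M (M - i) else 0

lemma recA_pos (i : ℕ) : 0 < recA i := by unfold recA; positivity

/-- The three cases at the end correspond to two, one or none of the later entries lying beyond `M`.
-/
lemma backEntry_recurrence (μ : ℝ) (t : ℕ → ℝ) (M i : ℕ) (hi : i ≠ 0) (hM : i ≤ M) :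
    recA i * backEntry μ t M i + (recB μ i + 1) * backEntry μ t M (i + 1)
      + recCPred μ (i + 1) * backEntry μ t M (i + 2) = t i := by
  have ha := (recA_pos i).ne'
  unfold backEntry
  rw [if_neg hi, if_pos hM, if_neg (show i + 1 ≠ 0 by omega), if_neg (show i + 2 ≠ 0 by omega)]
  obtain ⟨k, rfl⟩ : ∃ k, M = i + k := ⟨M - i, by omega⟩
  rw [Nat.add_sub_cancel_left]
  rcases k with _ | _ | k
  · rw [if_neg (by omega), if_neg (by omega), backSolve,
      Nat.add_zero, mul_zero, mul_zero, add_zero, add_zero, one_div, mul_inv_cancel_left₀ ha]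
  · rw [if_pos (by omega), if_neg (by omega), backSolve,
      show i + (0 + 1) - (i + 1) = 0 by omega, show i + (0 + 1) - 1 = i by omega]
    field_simp; ring
  · rw [if_pos (by omega), if_pos (by omega), backSolve,
      show i + (k + 1 + 1) - (i + 1) = k + 1 by omega, show i + (k + 1 + 1) - (i + 2) = k by omega,
      show i + (k + 1 + 1) - (k + 2) = i by omega]
    field_simp; ring

/-- The quotient `∑ ϱ̂_{l+1,j} P_l^{(μ,1-μ)}` of a cardinal polynomial by `1 + x`. -/
def hatPoly (α β μ : ℝ) {N : ℕ} (x : Fin (N + 1) → ℝ) (j : Fin (N + 1)) : ℝ[X] :=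
  ∑ l ∈ Finset.range (N - 1), C (rhoHat α β μ x (l + 1) j) * jacobi μ (1 - μ) l

lemma IsJGLNodes.cardinal_eq_hatPoly {α β μ : ℝ} {N : ℕ} {x : Fin (N + 1) → ℝ}
    (hx : IsJGLNodes α β N x) (hN : 1 ≤ N) (hα : -1 < α) (hβ : -1 < β) (hμ₁ : 1 < μ)
    (hμ₂ : μ < 2) {j : Fin (N + 1)} (hj : j ≠ Fin.last N) :
    cardinal x j = C (if j = 0 then 1 else 0) + (1 + X) * hatPoly α β μ x j := by
  obtain ⟨M, rfl⟩ : ∃ M, N = M + 1 := ⟨N - 1, by omega⟩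
  set t : ℕ → ℝ := fun l => rhoTilde α β μ x l j with ht
  set H := backEntry μ t M
  have hH : hatPoly α β μ x j =
      ∑ l ∈ Finset.range M, C (H (l + 1)) * jacobi μ (1 - μ) l := by
    unfold hatPoly
    apply Finset.sum_congr rfl
    intro l hl
    have := Finset.mem_range.mp hl
    simp only [H, backEntry, rhoHat, Nat.add_sub_cancel]
    rw [if_neg (by omega), if_neg (by omega), if_pos (by omega)]
  have hmul := one_add_X_mul_sum_jacobi μ M H (by simp [H, backEntry])
    (fun i hi => by simp only [H, backEntry]; rw [if_neg (by omega : i ≠ 0), if_neg (by omega)])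
  rw [← hH, Finset.sum_range_succ'] at hmul
  have hcard := hx.cardinal_eq_sum_rhoTilde hN hα hβ hμ₁ hμ₂ hj
  rw [Finset.sum_range_succ'] at hcard
  have hsum : ∑ k ∈ Finset.range M, C (recA (k + 1) * H (k + 1) + (recB μ (k + 1) + 1) *
      H (k + 1 + 1) + recCPred μ (k + 1 + 1) * H (k + 1 + 2)) * jacobi μ (1 - μ) (k + 1) =
      ∑ k ∈ Finset.range M, C (rhoTilde α β μ x (k + 1) j) * jacobi μ (1 - μ) (k + 1) := by
    apply Finset.sum_congr rfl
    intro k hk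
    have := Finset.mem_range.mp hk
    rw [backEntry_recurrence μ t M (k + 1) (by omega) (by omega)]
  rw [hsum, jacobi_zero] at hmul
  rw [jacobi_zero] at hcard
  -- The recurrence matches all coefficients of index at least `1`, so the two sides differ by a
  -- constant, which evaluation at `-1` identifies.
  obtain ⟨r, hr⟩ : ∃ r : ℝ, cardinal x j = C r + (1 + X) * hatPoly α β μ x j := by
    refine ⟨rhoTilde α β μ x 0 j - (recA 0 * H 0 + (recB μ 0 + 1) * H (0 + 1) +
      recCPred μ (0 + 1) * H (0 + 2)), ?_⟩
    rw [hcard, hmul, C_sub]; ring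
  have hev := congrArg (fun p => p.eval (-1)) hr
  simp only [eval_add, eval_mul, eval_C, eval_one, eval_X, add_neg_cancel, zero_mul, add_zero]
    at hev
  rw [← hx.first, eval_cardinal hx.strictMono.injective (last_ne_zero hN) hj] at hev
  rw [hr, ← hev]
  simp only [eq_comm]

end

/-! ### The fractional derivative on powers of `1 + x`. -/

section

open MeasureTheory Set

lemma rlIntegral_sum_pow {ρ : ℝ} (hρ : 0 < ρ) (n : ℕ) (c : ℕ → ℝ) {x : ℝ} (hx : -1 < x) :
    rlIntegral ρ (fun y => ∑ k ∈ Finset.range n, c k * (1 + y) ^ k) x =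
      ∑ k ∈ Finset.range n,
        c k * (Real.Gamma (k + 1) / Real.Gamma (k + 1 + ρ)) * (1 + x) ^ ((k : ℝ) + ρ) := by
  have hk : ∀ k : ℕ, (0 : ℝ) < (k : ℝ) + 1 := fun k => by positivity
  have e : ∫ y in (-1 : ℝ)..x, (∑ k ∈ Finset.range n, c k * (1 + y) ^ k) / (x - y) ^ (1 - ρ) =
      ∫ y in (-1 : ℝ)..x, ∑ k ∈ Finset.range n,
        c k * ((y - -1) ^ ((k : ℝ) + 1 - 1) * (x - y) ^ (ρ - 1)) := by
    apply intervalIntegral.integral_congr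
    intro y hy
    rw [uIcc_of_le hx.le] at hy
    simp only
    rw [Finset.sum_div]
    apply Finset.sum_congr rfl
    intro k _
    rw [add_sub_cancel_right, Real.rpow_natCast, show ρ - 1 = -(1 - ρ) by ring,
      Real.rpow_neg (by linarith [hy.2]), sub_neg_eq_add, add_comm y]
    ring
  unfold rlIntegral
  rw [e, intervalIntegral.integral_finsetSum]
  · rw [Finset.mul_sum]
    apply Finset.sum_congr rfl
    intro k _
    rw [intervalIntegral.integral_const_mul, integral_beta_interval (hk k) hρ hx,
      show (k : ℝ) + 1 + ρ - 1 = k + ρ by ring, sub_neg_eq_add, add_comm x]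
    have := (Real.Gamma_pos_of_pos hρ).ne'
    field_simp
  · intro k _
    exact (intervalIntegrable_beta_interval (hk k) hρ hx).const_mul _

lemma hasDerivAt_sum_rpow (n : ℕ) (c s : ℕ → ℝ) {x : ℝ} (hx : -1 < x) :
    HasDerivAt (fun y => ∑ k ∈ Finset.range n, c k * (1 + y) ^ s k)
      (∑ k ∈ Finset.range n, c k * s k * (1 + x) ^ (s k - 1)) x := by
  apply HasDerivAt.fun_sum
  intro k _
  have := ((hasDerivAt_id x).const_add 1).rpow_const (p := s k)
    (Or.inl (by rw [id]; linarith))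
  refine (this.const_mul (c k)).congr_deriv ?_
  simp; ring

/-- The Beta integral gives the fractional integral of each power; two differentiations lower the
exponent by two, and the functional equation of `Γ` absorbs the factors. -/
lemma modRlDeriv_sum_pow {μ : ℝ} (hμ₁ : 1 < μ) (hμ₂ : μ < 2) (n : ℕ) (c : ℕ → ℝ) {x : ℝ}
    (hx : -1 < x) :
    modRlDeriv μ (fun y => ∑ k ∈ Finset.range n, c k * (1 + y) ^ k) x =
      ∑ k ∈ Finset.range n,
        c k * (Real.Gamma (k + 1) / Real.Gamma (k + 1 - μ)) * (1 + x) ^ k := by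
  have hceil : ⌈μ⌉₊ = 2 := by
    rw [Nat.ceil_eq_iff (by norm_num)]; norm_num; exact ⟨hμ₁, hμ₂.le⟩
  unfold modRlDeriv rlDeriv
  rw [hceil]
  push_cast
  set e : ℕ → ℝ := fun k => c k * (Real.Gamma (k + 1) / Real.Gamma (k + 1 + (2 - μ))) with he
  -- The closed form of the integral is available only to the right of `-1`, so the derivatives are
  -- computed from equality near `x`.
  have hopen : ∀ᶠ y in nhds x, -1 < y := lt_mem_nhds hx
  have h0 : rlIntegral (2 - μ) (fun y => ∑ k ∈ Finset.range n, c k * (1 + y) ^ k) =ᶠ[nhds x]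
      fun y => ∑ k ∈ Finset.range n, e k * (1 + y) ^ ((k : ℝ) + (2 - μ)) := by
    filter_upwards [hopen] with y hy
    exact rlIntegral_sum_pow (by linarith) n c hy
  have h1 : deriv (fun y => ∑ k ∈ Finset.range n, e k * (1 + y) ^ ((k : ℝ) + (2 - μ))) =ᶠ[nhds x]
      fun y => ∑ k ∈ Finset.range n,
        e k * ((k : ℝ) + (2 - μ)) * (1 + y) ^ ((k : ℝ) + (2 - μ) - 1) := by
    filter_upwards [hopen] with y hy
    exact (hasDerivAt_sum_rpow n e (fun k => (k : ℝ) + (2 - μ)) hy).deriv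
  rw [h0.iteratedDeriv_eq, iteratedDeriv_succ, iteratedDeriv_one, h1.deriv_eq,
    (hasDerivAt_sum_rpow n (fun k => e k * ((k : ℝ) + (2 - μ)))
      (fun k => (k : ℝ) + (2 - μ) - 1) hx).deriv, Finset.mul_sum]
  apply Finset.sum_congr rfl
  intro k _
  have hpos : 0 < 1 + x := by linarith
  have hk : (0 : ℝ) ≤ k := k.cast_nonneg
  have n1 : (k : ℝ) + 1 - μ ≠ 0 := by
    rcases k with _ | k
    · push_cast; intro h; linarith
    · push_cast; have : (0 : ℝ) ≤ k := k.cast_nonneg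
      intro h; linarith
  have n2 : (k : ℝ) + 2 - μ ≠ 0 := by intro h; linarith
  have g1 := Real.Gamma_add_one n1
  have g2 := Real.Gamma_add_one n2
  rw [show (k : ℝ) + 1 - μ + 1 = k + 2 - μ by ring] at g1
  rw [g1] at g2
  have hp : (1 + x) ^ μ * (1 + x) ^ ((k : ℝ) + (2 - μ) - 1 - 1) = (1 + x) ^ k := by
    rw [← Real.rpow_add hpos, ← Real.rpow_natCast]; congr 1; ring
  rw [he]
  simp only
  rw [show (k : ℝ) + 1 + (2 - μ) = k + 2 - μ + 1 by ring, g2, ← hp]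
  have hG : Real.Gamma (k + 1 - μ) ≠ 0 := by
    intro h
    rw [h, mul_zero] at g1
    exact (Real.Gamma_pos_of_pos (by linarith : 0 < (k : ℝ) + 2 - μ)).ne' g1
  rw [show (k : ℝ) + (2 - μ) = k + 2 - μ by ring, show (k : ℝ) + 2 - μ - 1 = k + 1 - μ by ring]
  field_simp

/-! ### The lift, its action on Jacobi polynomials and its values at `1`. -/

/-- The inverse of the modified derivative composed with multiplication by `1 + x`, up to
constants: the linear map `(1 + x)^k ↦ d_k (1 + x)^{k+1}`. -/
def lift (μ : ℝ) : ℝ[X] →ₗ[ℝ] ℝ[X] :=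
  (Polynomial.lsum fun k => LinearMap.toSpanSingleton ℝ ℝ[X] (C (dCoeff μ k) * (1 + X) ^ (k + 1)))
    ∘ₗ taylor (-1)

lemma lift_C_mul (μ c : ℝ) (p : ℝ[X]) : lift μ (C c * p) = C c * lift μ p := by
  rw [← smul_eq_C_mul, map_smul, smul_eq_C_mul]

lemma lift_pow (μ : ℝ) (k : ℕ) :
    lift μ ((1 + X) ^ k) = C (dCoeff μ k) * (1 + X) ^ (k + 1) := by
  have : taylor (-1 : ℝ) ((1 + X) ^ k) = monomial k 1 := by
    rw [taylor_apply, pow_comp, add_comp, one_comp, X_comp, ← X_pow_eq_monomial]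
    simp
  rw [lift, LinearMap.comp_apply, this, Polynomial.lsum_apply, sum_monomial_index]
  · simp
  · simp

lemma lift_sum_pow (μ : ℝ) (n : ℕ) (c : ℕ → ℝ) :
    lift μ (∑ k ∈ Finset.range n, C (c k) * (1 + X) ^ k) =
      ∑ k ∈ Finset.range n, C (c k * dCoeff μ k) * (1 + X) ^ (k + 1) := by
  rw [map_sum]
  apply Finset.sum_congr rfl
  intro k _
  rw [lift_C_mul, lift_pow, C_mul, mul_assoc]

lemma exists_sum_pow (p : ℝ[X]) {n : ℕ} (hn : p.natDegree < n) :
    ∃ c : ℕ → ℝ, p = ∑ k ∈ Finset.range n, C (c k) * (1 + X) ^ k := by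
  refine ⟨fun k => (taylor (-1) p).coeff k, ?_⟩
  conv_lhs => rw [← sum_taylor_eq p (-1)]
  rw [sum_over_range' _ (by simp) n (by rwa [natDegree_taylor])]
  simp [add_comm]

lemma degree_sum_pow_lt (n : ℕ) (c : ℕ → ℝ) :
    (∑ k ∈ Finset.range n, C (c k) * (1 + X : ℝ[X]) ^ k).degree < n := by
  rw [← mem_degreeLT]
  apply Submodule.sum_mem
  intro k hk
  rw [mem_degreeLT]
  refine lt_of_le_of_lt (degree_const_mul_le _ _) ?_
  rw [show (1 + X : ℝ[X]) = X + C 1 by simp [add_comm], degree_pow, degree_X_add_C]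
  simpa using Finset.mem_range.mp hk

lemma eval_lift_neg_one (μ : ℝ) (p : ℝ[X]) : (lift μ p).eval (-1) = 0 := by
  obtain ⟨c, hc⟩ := exists_sum_pow p (Nat.lt_succ_self _)
  rw [hc, lift_sum_pow, eval_finsetSum]
  apply Finset.sum_eq_zero
  intro k _
  simp

lemma natDegree_lift_le (μ : ℝ) {p : ℝ[X]} {N : ℕ} (hp : p.degree < N) :
    (lift μ p).natDegree ≤ N := by
  by_cases h0 : p = 0
  · simp [h0]
  obtain ⟨c, hc⟩ := exists_sum_pow p ((natDegree_lt_iff_degree_lt h0).mpr hp)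
  rw [hc, lift_sum_pow]
  apply natDegree_sum_le_of_forall_le
  intro k hk
  refine (natDegree_C_mul_le _ _).trans ?_
  rw [show (1 + X : ℝ[X]) = X + C 1 by simp [add_comm], natDegree_pow, natDegree_X_add_C]
  have := Finset.mem_range.mp hk
  omega

lemma dCoeff_pos {μ : ℝ} (hμ₂ : μ < 2) (l : ℕ) : 0 < dCoeff μ l := by
  have : (0 : ℝ) ≤ l := l.cast_nonneg
  have := Real.Gamma_pos_of_pos (by linarith : 0 < (l : ℝ) + 2 - μ)
  have := Nat.factorial_pos (l + 1)
  unfold dCoeff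
  positivity

/-- The modified derivative of `q + lift p`. -/
lemma modRlDeriv_add_lift {μ : ℝ} (hμ₁ : 1 < μ) (hμ₂ : μ < 2) (q : ℝ) (p : ℝ[X]) {y : ℝ}
    (hy : -1 < y) :
    modRlDeriv μ (fun y => (C q + lift μ p).eval y) y =
      q / Real.Gamma (1 - μ) + (1 + y) * p.eval y := by
  obtain ⟨c, hc⟩ := exists_sum_pow p (Nat.lt_succ_self _)
  set n := p.natDegree.succ
  set f : ℕ → ℝ := fun k => if k = 0 then q else c (k - 1) * dCoeff μ (k - 1) with hf
  have e : (fun y => (C q + lift μ p).eval y) =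
      fun y => ∑ k ∈ Finset.range (n + 1), f k * (1 + y) ^ k := by
    ext y
    rw [Finset.sum_range_succ', hc, lift_sum_pow, eval_add, eval_finsetSum]
    simp [hf, add_comm]
  rw [e, modRlDeriv_sum_pow hμ₁ hμ₂ _ _ hy, Finset.sum_range_succ']
  conv_rhs => rw [hc, eval_finsetSum, Finset.mul_sum]
  rw [add_comm]
  congr 1
  · simp [hf, div_eq_mul_inv]
  · apply Finset.sum_congr rfl
    intro k _
    simp only [hf, Nat.succ_ne_zero, if_false, Nat.add_sub_cancel, dCoeff, eval_mul, eval_C,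
      eval_pow, eval_add, eval_one, eval_X]
    have hk : (0 : ℝ) ≤ k := k.cast_nonneg
    -- The derivative multiplies `(1+x)^{k+1}` by `Γ(k+2)/Γ(k+2-μ)`, the inverse of `d_k`.
    rw [Real.Gamma_nat_eq_factorial (k + 1),
      show (((k + 1 : ℕ) : ℝ)) + 1 - μ = k + 2 - μ by push_cast; ring]
    have := (Real.Gamma_pos_of_pos (by linarith : 0 < (k : ℝ) + 2 - μ)).ne'
    have := Nat.factorial_ne_zero (k + 1)
    field_simp
    ring

/-- After division of `Q - Q(-1)` by `1 + x`, the lift is inverted term by term, as every `d_k` is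
nonzero. -/
lemma exists_eq_C_add_lift {μ : ℝ} (hμ₂ : μ < 2) {N : ℕ} (hN : 1 ≤ N) {Q : ℝ[X]}
    (hQ : Q.natDegree ≤ N) : ∃ p : ℝ[X], p.degree < N ∧ Q = C (Q.eval (-1)) + lift μ p := by
  have hroot : (Q - C (Q.eval (-1))).IsRoot (-1) := by simp
  obtain ⟨R, hR⟩ := dvd_iff_isRoot.mpr hroot
  have hRdeg : R.natDegree < N := by
    by_cases h0 : R = 0
    · rw [h0, natDegree_zero]; omega
    · have h := congrArg natDegree hR
      rw [natDegree_mul (X_sub_C_ne_zero _) h0, natDegree_X_sub_C, natDegree_sub_C] at h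
      omega
  obtain ⟨c, hc⟩ := exists_sum_pow R hRdeg
  refine ⟨∑ k ∈ Finset.range N, C (c k / dCoeff μ k) * (1 + X) ^ k, degree_sum_pow_lt _ _, ?_⟩
  rw [lift_sum_pow, ← sub_eq_iff_eq_add', hR]
  conv_lhs => rw [hc, Finset.mul_sum]
  apply Finset.sum_congr rfl
  intro k _
  rw [div_mul_cancel₀ _ (dCoeff_pos hμ₂ k).ne', C_neg, C_1]
  ring

lemma Gamma_add_nat_eq {y : ℝ} (hy : 0 < y) (n : ℕ) :
    Real.Gamma (y + n) = (ascPochhammer ℝ n).eval y * Real.Gamma y := by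
  induction n with
  | zero => simp
  | succ n ih =>
    have : (0 : ℝ) ≤ n := n.cast_nonneg
    rw [Nat.cast_succ, ← add_assoc, Real.Gamma_add_one (by linarith), ih, ascPochhammer_succ_eval]
    ring

/-- The reflection formula moves the centre of expansion from `1` to `-1`, where `lift` is diagonal.
-/
lemma jacobi_eq_sum_pow {a b : ℝ} (ha : -1 < a) (hb : -1 < b) (l : ℕ) :
    jacobi a b l = ∑ k ∈ Finset.range (l + 1),
      C ((-1) ^ l * jacobiCoeff b a l k * (-1 / 2) ^ k) * (1 + X) ^ k := by
  rw [jacobi_comp_neg ha hb, jacobi_eq_comp, comp_assoc, shiftedJacobi, Polynomial.sum_comp,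
    Finset.mul_sum]
  apply Finset.sum_congr rfl
  intro k _
  have : (C (1 / 2) * (X - 1) : ℝ[X]).comp (-X) = C (-1 / 2) * (1 + X) := by
    rw [mul_comp, C_comp, sub_comp, X_comp, one_comp, neg_div, C_neg]; ring
  rw [mul_comp, C_comp, pow_comp, X_comp, this, mul_pow, C_mul, C_mul, ← C_pow]
  ring

/-- The fractional integration formula between Jacobi polynomials. -/
lemma lift_jacobi {μ : ℝ} (hμ₁ : 1 < μ) (hμ₂ : μ < 2) (l : ℕ) :
    lift μ (jacobi μ (1 - μ) l) = C (dCoeff μ l) * phi l := by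
  rw [phi, jacobi_eq_sum_pow (by linarith) (by linarith),
    jacobi_eq_sum_pow (by norm_num) (by norm_num), lift_sum_pow, Finset.mul_sum, Finset.mul_sum]
  apply Finset.sum_congr rfl
  intro k hk
  have hkl : k ≤ l := by simpa [Nat.lt_succ_iff] using hk
  obtain ⟨m, rfl⟩ := Nat.exists_eq_add_of_le hkl
  have hk0 : (0 : ℝ) ≤ k := k.cast_nonneg
  -- Both parameter pairs sum to `1`, so the first Pochhammer symbols agree. The second ones,
  -- `(k+2-μ)_m` and `(k+2)_m`, are Gamma quotients that convert `d_k` into `d_{k+m}`.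
  have key : jacobiCoeff (1 - μ) μ (k + m) k * dCoeff μ k =
      dCoeff μ (k + m) * jacobiCoeff 1 0 (k + m) k := by
    have g1 := Gamma_add_nat_eq (y := (k : ℝ) + 2 - μ) (by linarith) m
    have g2 := Gamma_add_nat_eq (y := (k : ℝ) + 2) (by linarith) m
    have f1 := Real.Gamma_nat_eq_factorial (k + 1)
    have f2 := Real.Gamma_nat_eq_factorial (k + m + 1)
    push_cast at f1 f2
    rw [show (k : ℝ) + 1 + 1 = k + 2 by ring] at f1
    rw [show (k : ℝ) + m + 1 + 1 = k + 2 + m by ring, g2, f1] at f2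
    unfold jacobiCoeff dCoeff
    rw [← f2, Nat.add_sub_cancel_left, show 1 - μ + k + 1 = (k : ℝ) + 2 - μ by ring,
      show (1 : ℝ) + k + 1 = k + 2 by ring]
    push_cast
    rw [show (k : ℝ) + m + 2 - μ = k + 2 - μ + m by ring, g1,
      show (k : ℝ) + m + (1 - μ) + μ + 1 = k + m + 1 + 0 + 1 by ring]
    have := Nat.factorial_ne_zero (k + 1)
    have := Nat.factorial_ne_zero k
    have := Nat.factorial_ne_zero m
    have := (ascPochhammer_pos m ((k : ℝ) + 2) (by linarith)).ne'
    field_simp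
  rw [show (-1 : ℝ) ^ (k + m) * jacobiCoeff (1 - μ) μ (k + m) k * (-1 / 2) ^ k * dCoeff μ k =
    dCoeff μ (k + m) * ((-1) ^ (k + m) * jacobiCoeff 1 0 (k + m) k * (-1 / 2) ^ k) by
      linear_combination (-1 : ℝ) ^ (k + m) * (-1 / 2) ^ k * key, C_mul]
  ring

lemma eval_one_phi (l : ℕ) : (phi l).eval 1 = 2 := by
  rw [phi, eval_mul, eval_one_jacobi, zero_add, ascPochhammer_eval_one]
  have := Nat.factorial_ne_zero l
  simp
  field_simp
  norm_num

lemma lift_sum_jacobi {μ : ℝ} (hμ₁ : 1 < μ) (hμ₂ : μ < 2) (n : ℕ) (e : ℕ → ℝ) :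
    lift μ (∑ l ∈ Finset.range n, C (e l) * jacobi μ (1 - μ) l) =
      ∑ l ∈ Finset.range n, C (dCoeff μ l * e l) * phi l := by
  rw [map_sum]
  apply Finset.sum_congr rfl
  intro l _
  rw [lift_C_mul, lift_jacobi hμ₁ hμ₂, C_mul]
  ring

lemma eval_one_lift_sum_jacobi {μ : ℝ} (hμ₁ : 1 < μ) (hμ₂ : μ < 2) (n : ℕ) (e : ℕ → ℝ) :
    (lift μ (∑ l ∈ Finset.range n, C (e l) * jacobi μ (1 - μ) l)).eval 1 =
      2 * ∑ l ∈ Finset.range n, dCoeff μ l * e l := by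
  rw [lift_sum_jacobi hμ₁ hμ₂, eval_finsetSum, Finset.mul_sum]
  apply Finset.sum_congr rfl
  intro l _
  rw [eval_mul, eval_C, eval_one_phi, mul_comm]

lemma dCoeff_succ {μ : ℝ} (hμ₂ : μ < 2) (l : ℕ) :
    dCoeff μ (l + 1) = dCoeff μ l * ((l + 2 - μ) / (l + 2)) := by
  have : (0 : ℝ) ≤ l := l.cast_nonneg
  unfold dCoeff
  rw [Nat.factorial_succ (l + 1)]
  push_cast
  rw [show (l : ℝ) + 1 + 2 - μ = l + 2 - μ + 1 by ring, Real.Gamma_add_one (by linarith)]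
  have := Nat.factorial_ne_zero (l + 1)
  field_simp
  ring

/-- For `l = 0` the truncated index `l - 1` is harmless because `c_{-1} = 0`. -/
lemma dCoeff_pred_mul {μ : ℝ} (hμ₂ : μ < 2) (l : ℕ) :
    dCoeff μ (l - 1) * recCPred μ l =
      dCoeff μ l * ((l + 1) / (l + 1 - μ) * recCPred μ l) := by
  rcases l with _ | l
  · simp [recCPred]
  · have : (0 : ℝ) ≤ l := l.cast_nonneg
    rw [Nat.add_sub_cancel, dCoeff_succ hμ₂]
    have : (l : ℝ) + 2 - μ ≠ 0 := by linarith
    have : (l : ℝ) + 1 + 1 - μ ≠ 0 := by linarith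
    push_cast
    field_simp
    ring

/-- The lift of `x P_l^{(μ,1-μ)}`. -/
lemma lift_X_mul_jacobi {μ : ℝ} (hμ₁ : 1 < μ) (hμ₂ : μ < 2) (l : ℕ) :
    lift μ (X * jacobi μ (1 - μ) l) = C (dCoeff μ l) *
      (C ((l + 2 - μ) / (l + 2) * recA (l + 1)) * phi (l + 1) + C (recB μ l) * phi l
        + C ((l + 1) / (l + 1 - μ) * recCPred μ l) * phi (l - 1)) := by
  have h1 := dCoeff_succ hμ₂ l
  have h2 := dCoeff_pred_mul hμ₂ l
  rw [jacobi_three_term, map_add, map_add, lift_C_mul, lift_C_mul, lift_C_mul,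
    lift_jacobi hμ₁ hμ₂, lift_jacobi hμ₁ hμ₂, lift_jacobi hμ₁ hμ₂, h1]
  have h3 := congrArg (C : ℝ → ℝ[X]) h2
  simp only [C_mul] at h3 ⊢
  linear_combination phi (l - 1) * h3

/-- The three coefficients in `lift_X_mul_jacobi` sum to `1` for `l ≥ 1`. For `l = 0` the absent
`c_{-1}` term leaves `1 - μ`, and the defect `μ d_0 = μ Γ(2-μ)` is the constant in `tau`. -/
lemma eval_one_lift_X_mul_jacobi {μ : ℝ} (hμ₁ : 1 < μ) (hμ₂ : μ < 2) (l : ℕ) :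
    (lift μ (X * jacobi μ (1 - μ) l)).eval 1 =
      2 * (dCoeff μ l - if l = 0 then μ * Real.Gamma (2 - μ) else 0) := by
  rw [lift_X_mul_jacobi hμ₁ hμ₂]
  simp only [eval_mul, eval_add, eval_C, eval_one_phi]
  have hl : (0 : ℝ) ≤ l := l.cast_nonneg
  rcases l with _ | l
  · simp only [recA, recB, recCPred, dCoeff, if_true]
    norm_num
    field_simp
    ring
  · simp only [recA, recB, recCPred, Nat.succ_ne_zero, if_false]
    push_cast at hl ⊢
    have : (l : ℝ) + 1 + 1 - μ ≠ 0 := by linarith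
    have : (l : ℝ) + 1 - μ + 1 ≠ 0 := by linarith
    field_simp
    ring

lemma lift_X_mul_hatPoly {α β μ : ℝ} (hμ₁ : 1 < μ) (hμ₂ : μ < 2) {N : ℕ} (x : Fin (N + 1) → ℝ)
    (j : Fin (N + 1)) :
    lift μ (X * hatPoly α β μ x j) = ∑ l ∈ Finset.range (N - 1),
      C (dCoeff μ l * rhoHat α β μ x (l + 1) j) *
        (C ((l + 2 - μ) / (l + 2) * recA (l + 1)) * phi (l + 1) + C (recB μ l) * phi l
          + C ((l + 1) / (l + 1 - μ) * recCPred μ l) * phi (l - 1)) := by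
  rw [hatPoly, Finset.mul_sum, map_sum]
  apply Finset.sum_congr rfl
  intro l _
  rw [mul_left_comm, lift_C_mul, lift_X_mul_jacobi hμ₁ hμ₂, ← mul_assoc, ← C_mul,
    mul_comm (rhoHat α β μ x (l + 1) j)]

lemma eval_one_lift_X_mul_hatPoly {α β μ : ℝ} (hμ₁ : 1 < μ) (hμ₂ : μ < 2) {N : ℕ} (hN : 2 ≤ N)
    (x : Fin (N + 1) → ℝ) (j : Fin (N + 1)) :
    (lift μ (X * hatPoly α β μ x j)).eval 1 =
      2 * (hatSum α β μ x j - μ * Real.Gamma (2 - μ) * rhoHat α β μ x 1 j) := by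
  obtain ⟨M, rfl⟩ : ∃ M, N = M + 2 := ⟨N - 2, by omega⟩
  rw [hatPoly, Finset.mul_sum, map_sum, eval_finsetSum, hatSum,
    show M + 2 - 1 = M + 1 by omega, Finset.sum_range_succ', Finset.sum_range_succ' (n := M)]
  have : ∀ l : ℕ, (lift μ (X * (C (rhoHat α β μ x (l + 1) j) * jacobi μ (1 - μ) l))).eval 1 =
      rhoHat α β μ x (l + 1) j *
        (2 * (dCoeff μ l - if l = 0 then μ * Real.Gamma (2 - μ) else 0)) := by
    intro l
    rw [mul_left_comm, lift_C_mul, eval_mul, eval_C, eval_one_lift_X_mul_jacobi hμ₁ hμ₂]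
  simp only [this, Nat.succ_ne_zero, if_false, if_true, sub_zero]
  have e : ∑ l ∈ Finset.range M, rhoHat α β μ x (l + 1 + 1) j * (2 * dCoeff μ (l + 1)) =
      2 * ∑ l ∈ Finset.range M, dCoeff μ (l + 1) * rhoHat α β μ x (l + 1 + 1) j := by
    rw [Finset.mul_sum]; exact Finset.sum_congr rfl fun l _ => by ring
  rw [e]
  ring

end

/-! ### Solvability of the Birkhoff problem. -/

variable {α β μ : ℝ} {N : ℕ} {x : Fin (N + 1) → ℝ}

lemma degree_hatPoly_lt (α β μ : ℝ) {N : ℕ} (x : Fin (N + 1) → ℝ) (j : Fin (N + 1)) :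
    (hatPoly α β μ x j).degree < (N - 1 : ℕ) := by
  rw [← mem_degreeLT]
  apply Submodule.sum_mem
  intro l hl
  rw [mem_degreeLT]
  refine lt_of_le_of_lt (degree_const_mul_le _ _) ?_
  refine lt_of_le_of_lt (degree_le_of_natDegree_le (natDegree_jacobi_le _ _ l)) ?_
  exact_mod_cast Finset.mem_range.mp hl

lemma degree_hatPoly_lt' (α β μ : ℝ) {N : ℕ} (x : Fin (N + 1) → ℝ) (j : Fin (N + 1)) :
    (hatPoly α β μ x j).degree < N :=
  (degree_hatPoly_lt α β μ x j).trans_le (by exact_mod_cast Nat.sub_le N 1)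

lemma lift_hatPoly (hμ₁ : 1 < μ) (hμ₂ : μ < 2) (j : Fin (N + 1)) :
    lift μ (hatPoly α β μ x j) = ∑ l ∈ Finset.range (N - 1),
      C (dCoeff μ l * rhoHat α β μ x (l + 1) j) * phi l :=
  lift_sum_jacobi hμ₁ hμ₂ _ fun l => rhoHat α β μ x (l + 1) j

lemma eval_one_lift_hatPoly (hμ₁ : 1 < μ) (hμ₂ : μ < 2) (j : Fin (N + 1)) :
    (lift μ (hatPoly α β μ x j)).eval 1 = 2 * hatSum α β μ x j :=
  eval_one_lift_sum_jacobi hμ₁ hμ₂ _ fun l => rhoHat α β μ x (l + 1) j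

lemma IsJGLNodes.lift_cardinal_zero (hx : IsJGLNodes α β N x) (hN : 1 ≤ N) (hα : -1 < α)
    (hβ : -1 < β) (hμ₁ : 1 < μ) (hμ₂ : μ < 2) :
    lift μ (cardinal x 0) = ∑ l ∈ Finset.range N,
      C (dCoeff μ l * rhoTilde α β μ x l 0) * phi l := by
  rw [hx.cardinal_eq_sum_rhoTilde hN hα hβ hμ₁ hμ₂ (last_ne_zero hN)]
  exact lift_sum_jacobi hμ₁ hμ₂ _ fun l => rhoTilde α β μ x l 0

lemma IsJGLNodes.eval_one_lift_cardinal_zero (hx : IsJGLNodes α β N x) (hN : 1 ≤ N)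
    (hα : -1 < α) (hβ : -1 < β) (hμ₁ : 1 < μ) (hμ₂ : μ < 2) :
    (lift μ (cardinal x 0)).eval 1 = 2 * tildeSum α β μ x := by
  rw [hx.cardinal_eq_sum_rhoTilde hN hα hβ hμ₁ hμ₂ (last_ne_zero hN)]
  exact eval_one_lift_sum_jacobi hμ₁ hμ₂ _ fun l => rhoTilde α β μ x l 0

/-- A polynomial of degree less than `N` vanishing at the interior nodes is a multiple of the
first cardinal polynomial. -/
lemma IsJGLNodes.eq_C_mul_cardinal_zero (hx : IsJGLNodes α β N x) (hN : 1 ≤ N) {p : ℝ[X]}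
    (hp : p.degree < N) (h : ∀ i, i ≠ 0 → i ≠ Fin.last N → p.eval (x i) = 0) :
    p = C (p.eval (-1)) * cardinal x 0 := by
  have hinj := hx.strictMono.injective
  have h0 := last_ne_zero hN
  apply eq_of_eval_eq_of_degree_lt hinj hp
    (lt_of_le_of_lt (degree_const_mul_le _ _) (degree_cardinal_lt hinj hN h0))
  intro i hi
  rw [eval_mul, eval_C, eval_cardinal hinj hi h0]
  split_ifs with hi0
  · rw [hi0, hx.first, mul_one]
  · rw [mul_zero, h i hi0 hi]

/-- The difference is a multiple of `cardinal x 0`, whose lift takes the value `2S ≠ 0` at `1`. -/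
lemma IsJGLNodes.eq_of_lift_eq (hx : IsJGLNodes α β N x) (hN : 1 ≤ N) (hα : -1 < α)
    (hβ : -1 < β) (hμ₁ : 1 < μ) (hμ₂ : μ < 2) (hS : tildeSum α β μ x ≠ 0) {p q : ℝ[X]}
    (hp : p.degree < N) (hq : q.degree < N)
    (h : ∀ i, i ≠ 0 → i ≠ Fin.last N → p.eval (x i) = q.eval (x i))
    (h1 : (lift μ p).eval 1 = (lift μ q).eval 1) : p = q := by
  have hd : (p - q).degree < N := lt_of_le_of_lt (degree_sub_le p q) (max_lt hp hq)
  have hpq := hx.eq_C_mul_cardinal_zero hN hd fun i hi hi' => by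
    rw [eval_sub, h i hi hi', sub_self]
  have he : (lift μ (p - q)).eval 1 = _ := congrArg (fun r => (lift μ r).eval 1) hpq
  beta_reduce at he
  rw [lift_C_mul, map_sub, eval_sub, h1, sub_self, eval_mul, eval_C, eval_sub,
    hx.eval_one_lift_cardinal_zero hN hα hβ hμ₁ hμ₂] at he
  have hz : p.eval (-1) - q.eval (-1) = 0 := by
    rcases mul_eq_zero.mp he.symm with h | h
    · exact h
    · exact absurd h (mul_ne_zero two_ne_zero hS)
  rw [eval_sub, hz, C_0, zero_mul] at hpq
  exact sub_eq_zero.mp hpq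

/-- The interior conditions of a Birkhoff basis in terms of the lifted polynomial. -/
lemma IsBirkhoffBasis.exists_lift {Q : Fin (N + 1) → ℝ[X]} (hQ : IsBirkhoffBasis μ x Q)
    (hx : IsJGLNodes α β N x) (hN : 1 ≤ N) (hμ₁ : 1 < μ) (hμ₂ : μ < 2) (j : Fin (N + 1)) :
    ∃ p : ℝ[X], p.degree < N ∧ Q j = C (if j = 0 then 1 else 0) + lift μ p ∧
      ∀ i, i ≠ 0 → i ≠ Fin.last N →
        (1 + x i) * p.eval (x i) =
          (if i = j then 1 else 0) - (if j = 0 then 1 else 0) / Real.Gamma (1 - μ) := by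
  obtain ⟨p, hp, hQp⟩ := exists_eq_C_add_lift hμ₂ hN (hQ.natDegree_le j)
  rw [hQ.eval_neg_one] at hQp
  refine ⟨p, hp, hQp, fun i hi hi' => ?_⟩
  have h := hQ.modRlDeriv_eq i j hi hi'
  rw [hQp, modRlDeriv_add_lift hμ₁ hμ₂ _ _ (hx.neg_one_lt hi)] at h
  linarith

lemma exists_isBirkhoffBasis (hx : IsJGLNodes α β N x) (hN : 1 ≤ N) (hα : -1 < α)
    (hβ : -1 < β) (hμ₁ : 1 < μ) (hμ₂ : μ < 2) (hS : tildeSum α β μ x ≠ 0) :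
    ∃ Q : Fin (N + 1) → ℝ[X], IsBirkhoffBasis μ x Q := by
  have hinj := hx.strictMono.injective
  -- The interior data are interpolated. At `x_0` the division by `1 + x_0 = 0` gives the value `0`;
  -- any value would do, since a multiple of `cardinal x 0` is added afterwards.
  set u : Fin (N + 1) → ℝ[X] := fun j => Lagrange.interpolate (Finset.univ.erase (Fin.last N)) x
    (fun i => ((if i = j then 1 else 0) - (if j = 0 then 1 else 0) / Real.Gamma (1 - μ)) /
      (1 + x i)) with hu
  have hudeg : ∀ j, (u j).degree < N := fun j => by
    have := Lagrange.degree_interpolate_lt (s := Finset.univ.erase (Fin.last N))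
      (r := fun i => ((if i = j then 1 else 0) - (if j = 0 then 1 else 0) / Real.Gamma (1 - μ)) /
      (1 + x i)) hinj.injOn
    rwa [Finset.card_erase_of_mem (by simp), Finset.card_univ, Fintype.card_fin,
      Nat.add_sub_cancel] at this
  have hueval : ∀ i j, i ≠ Fin.last N → (u j).eval (x i) =
      ((if i = j then 1 else 0) - (if j = 0 then 1 else 0) / Real.Gamma (1 - μ)) / (1 + x i) :=
    fun i j hi => Lagrange.eval_interpolate_at_node _ hinj.injOn (by simp [hi])
  -- Chosen so that adding `κ j` times `cardinal x 0` produces the required value at `1`.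
  set κ : Fin (N + 1) → ℝ := fun j =>
    ((if j = Fin.last N then 1 else 0) - (if j = 0 then 1 else 0) - (lift μ (u j)).eval 1) /
      (2 * tildeSum α β μ x) with hκ
  have h0 := last_ne_zero hN
  refine ⟨fun j => C (if j = 0 then 1 else 0) + lift μ (u j + C (κ j) * cardinal x 0),
    fun j => ?_, fun i j hi hi' => ?_, fun j => ?_, fun j => ?_⟩
  · rw [natDegree_C_add]
    apply natDegree_lift_le
    exact lt_of_le_of_lt (degree_add_le _ _) (max_lt (hudeg j)
      (lt_of_le_of_lt (degree_const_mul_le _ _) (degree_cardinal_lt hinj hN h0)))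
  · rw [modRlDeriv_add_lift hμ₁ hμ₂ _ _ (hx.neg_one_lt hi), eval_add, hueval i j hi', eval_mul,
      eval_cardinal hinj hi' h0, if_neg hi, mul_zero, add_zero, mul_div_cancel₀]
    · ring
    · linarith [hx.neg_one_lt hi]
  · rw [eval_add, eval_C, eval_lift_neg_one, add_zero]
  · rw [map_add, lift_C_mul, eval_add, eval_add, eval_mul, eval_C, eval_C,
      hx.eval_one_lift_cardinal_zero hN hα hβ hμ₁ hμ₂, div_mul_cancel₀]
    · ring
    · exact mul_ne_zero two_ne_zero hS

/-- The polynomial behind `Q_N` vanishes at the interior nodes, hence is a multiple of `cardinal x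
0`; so `1 = Q_N(1)` is a multiple of `2S`. -/
lemma IsBirkhoffBasis.tildeSum_ne_zero {Q : Fin (N + 1) → ℝ[X]} (hQ : IsBirkhoffBasis μ x Q)
    (hx : IsJGLNodes α β N x) (hN : 1 ≤ N) (hα : -1 < α) (hβ : -1 < β) (hμ₁ : 1 < μ)
    (hμ₂ : μ < 2) : tildeSum α β μ x ≠ 0 := by
  obtain ⟨p, hp, hQp, hpi⟩ := hQ.exists_lift hx hN hμ₁ hμ₂ (Fin.last N)
  have h0 := last_ne_zero hN
  have hpc := hx.eq_C_mul_cardinal_zero hN hp fun i hi hi' => by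
    have h := hpi i hi hi'
    rw [if_neg hi', if_neg h0.symm, zero_div, sub_zero] at h
    exact (mul_eq_zero.mp h).resolve_left (by linarith [hx.neg_one_lt hi])
  have h1 := hQ.eval_one (Fin.last N)
  intro hS
  rw [hQp, if_neg h0.symm, if_pos rfl, hpc, lift_C_mul, eval_add, eval_mul,
    hx.eval_one_lift_cardinal_zero hN hα hβ hμ₁ hμ₂, hS] at h1
  simp at h1

/-- A member of a Birkhoff basis is determined by the interior values of the lifted polynomial and
by the value at `1`. -/
lemma IsBirkhoffBasis.eq_C_add_lift {Q : Fin (N + 1) → ℝ[X]} (hQ : IsBirkhoffBasis μ x Q)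
    (hx : IsJGLNodes α β N x) (hN : 1 ≤ N) (hα : -1 < α) (hβ : -1 < β) (hμ₁ : 1 < μ)
    (hμ₂ : μ < 2) (j : Fin (N + 1)) {q : ℝ[X]} (hq : q.degree < N)
    (hqi : ∀ i, i ≠ 0 → i ≠ Fin.last N → (1 + x i) * q.eval (x i) =
      (if i = j then 1 else 0) - (if j = 0 then 1 else 0) / Real.Gamma (1 - μ))
    (hq1 : (lift μ q).eval 1 = (if j = Fin.last N then 1 else 0) - (if j = 0 then 1 else 0)) :
    Q j = C (if j = 0 then 1 else 0) + lift μ q := by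
  obtain ⟨p, hp, hQp, hpi⟩ := hQ.exists_lift hx hN hμ₁ hμ₂ j
  have hS := hQ.tildeSum_ne_zero hx hN hα hβ hμ₁ hμ₂
  have h1 := hQ.eval_one j
  rw [hQp, eval_add, eval_C] at h1
  rw [hQp, hx.eq_of_lift_eq hN hα hβ hμ₁ hμ₂ hS hp hq (fun i hi hi' => ?_) (by linarith)]
  have hne : 1 + x i ≠ 0 := by linarith [hx.neg_one_lt hi]
  exact mul_left_cancel₀ hne ((hpi i hi hi').trans (hqi i hi hi').symm)

/-- For interior `j` these are the interior conditions of `Q_j`; only the value at `1` remains to be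
corrected. -/
lemma IsJGLNodes.one_add_mul_eval_hatPoly (hx : IsJGLNodes α β N x) (hN : 1 ≤ N) (hα : -1 < α)
    (hβ : -1 < β) (hμ₁ : 1 < μ) (hμ₂ : μ < 2) {i j : Fin (N + 1)} (hi : i ≠ Fin.last N)
    (hj : j ≠ Fin.last N) : (1 + x i) * (hatPoly α β μ x j).eval (x i) =
      (if i = j then 1 else 0) - if j = 0 then 1 else 0 := by
  have h := congrArg (fun p => p.eval (x i)) (hx.cardinal_eq_hatPoly hN hα hβ hμ₁ hμ₂ hj)
  simp only [eval_cardinal hx.strictMono.injective hi hj, eval_add, eval_mul, eval_C, eval_one,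
    eval_X] at h
  linarith

lemma degree_X_add_C_mul_hatPoly_lt (hN : 1 ≤ N) (c : ℝ) (j : Fin (N + 1)) :
    ((X + C c) * hatPoly α β μ x j).degree < (N : WithBot ℕ) := by
  have h := degree_hatPoly_lt α β μ x j
  by_cases h0 : hatPoly α β μ x j = 0
  · rw [h0, mul_zero, degree_zero]; exact WithBot.bot_lt_coe N
  · rw [← natDegree_lt_iff_degree_lt h0] at h
    rw [← natDegree_lt_iff_degree_lt (mul_ne_zero (X_add_C_ne_zero c) h0),
      natDegree_mul (X_add_C_ne_zero c) h0, natDegree_X_add_C]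
    omega

/-- The value at `1` of the lift of `(x + τ_j) w_j` vanishes. -/
lemma eval_one_lift_X_add_tau_mul_hatPoly (hN : 2 ≤ N) (hμ₁ : 1 < μ) (hμ₂ : μ < 2)
    {j : Fin (N + 1)} (hS : hatSum α β μ x j ≠ 0) :
    (lift μ ((X + C (tau α β μ x j)) * hatPoly α β μ x j)).eval 1 = 0 := by
  rw [add_mul, map_add, lift_C_mul, eval_add, eval_mul, eval_C,
    eval_one_lift_X_mul_hatPoly hμ₁ hμ₂ hN, eval_one_lift_hatPoly hμ₁ hμ₂, tau]
  field_simp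
  ring

lemma two_le_of_interior {j : Fin (N + 1)} (hj : j ≠ 0) (hj' : j ≠ Fin.last N) : 2 ≤ N := by
  have h1 : 0 < j.val := Fin.pos_iff_ne_zero.mpr hj
  have h2 : j.val < N := Fin.lt_last_iff_ne_last.mpr hj'
  omega

/-- If the sum vanished, `(x + τ_j)` times `hatPoly` would be zero at all interior nodes with lift
zero at `1`, hence zero by `IsJGLNodes.eq_of_lift_eq`. But `hatPoly` is nonzero at `x_j`. -/
lemma IsBirkhoffBasis.add_tau_ne_zero
    {Q : Fin (N + 1) → ℝ[X]} (hQ : IsBirkhoffBasis μ x Q)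
    (hx : IsJGLNodes α β N x) (hN : 1 ≤ N) (hα : -1 < α) (hβ : -1 < β) (hμ₁ : 1 < μ)
    (hμ₂ : μ < 2) {j : Fin (N + 1)} (hj : j ≠ 0) (hj' : j ≠ Fin.last N)
    (hSj : hatSum α β μ x j ≠ 0) : x j + tau α β μ x j ≠ 0 := by
  intro h
  have hS := hQ.tildeSum_ne_zero hx hN hα hβ hμ₁ hμ₂
  have hw : (X + C (tau α β μ x j)) * hatPoly α β μ x j = 0 := by
    apply hx.eq_of_lift_eq hN hα hβ hμ₁ hμ₂ hS (degree_X_add_C_mul_hatPoly_lt hN _ j)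
      (by rw [degree_zero]; exact WithBot.bot_lt_coe N)
    · intro i hi hi'
      have hne : 1 + x i ≠ 0 := by linarith [hx.neg_one_lt hi]
      have hi2 := hx.one_add_mul_eval_hatPoly hN hα hβ hμ₁ hμ₂ hi' hj'
      rw [if_neg hj, sub_zero] at hi2
      apply mul_left_cancel₀ hne
      rw [eval_mul, mul_left_comm, hi2, eval_add, eval_X, eval_C, eval_zero, mul_zero]
      split_ifs with hij
      · rw [hij, h, zero_mul]
      · rw [mul_zero]
    · rw [eval_one_lift_X_add_tau_mul_hatPoly (two_le_of_interior hj hj') hμ₁ hμ₂ hSj]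
      simp
  have h0 := (mul_eq_zero.mp hw).resolve_left (X_add_C_ne_zero _)
  have h2 := hx.one_add_mul_eval_hatPoly hN hα hβ hμ₁ hμ₂ hj' hj'
  rw [h0, if_pos rfl, if_neg hj] at h2
  simp at h2

end FracBirkhoff

end

/-! ### Uniqueness of the basis and verification of the explicit formulas. -/

theorem theorem5p3 (N : ℕ) (hN : 1 ≤ N) (α β μ : ℝ) (hα : -1 < α) (hβ : -1 < β)
    (hμ₁ : 1 < μ) (hμ₂ : μ < 2) (x : Fin (N + 1) → ℝ)
    (hx : FracBirkhoff.IsJGLNodes α β N x) :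
    (FracBirkhoff.tildeSum α β μ x ≠ 0 →
      ∃! Q : Fin (N + 1) → Polynomial ℝ, FracBirkhoff.IsBirkhoffBasis μ x Q) ∧
    ∀ Q : Fin (N + 1) → Polynomial ℝ, FracBirkhoff.IsBirkhoffBasis μ x Q →
      FracBirkhoff.tildeSum α β μ x ≠ 0 ∧
      Q 0 = 1
        + Polynomial.C (FracBirkhoff.tauZero α β μ x - 1 / Real.Gamma (1 - μ)) *
          ∑ l ∈ Finset.range N,
            Polynomial.C (FracBirkhoff.dCoeff μ l * FracBirkhoff.rhoTilde α β μ x l 0) *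
              FracBirkhoff.phi l
        + Polynomial.C (1 / Real.Gamma (1 - μ)) *
          ∑ l ∈ Finset.range (N - 1),
            Polynomial.C (FracBirkhoff.dCoeff μ l * FracBirkhoff.rhoHat α β μ x (l + 1) 0) *
              FracBirkhoff.phi l ∧
      Q (Fin.last N) =
        Polynomial.C (1 / 2 / FracBirkhoff.tildeSum α β μ x) *
          ∑ l ∈ Finset.range N,
            Polynomial.C (FracBirkhoff.dCoeff μ l * FracBirkhoff.rhoTilde α β μ x l 0) *
              FracBirkhoff.phi l ∧
      ∀ j : Fin (N + 1), j ≠ 0 → j ≠ Fin.last N → FracBirkhoff.hatSum α β μ x j ≠ 0 →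
        x j + FracBirkhoff.tau α β μ x j ≠ 0 ∧
        Q j =
          Polynomial.C (FracBirkhoff.tau α β μ x j / (x j + FracBirkhoff.tau α β μ x j)) *
            ∑ l ∈ Finset.range (N - 1),
              Polynomial.C (FracBirkhoff.dCoeff μ l * FracBirkhoff.rhoHat α β μ x (l + 1) j) *
                FracBirkhoff.phi l
          + Polynomial.C (1 / (x j + FracBirkhoff.tau α β μ x j)) *
            ∑ l ∈ Finset.range (N - 1),
              Polynomial.C (FracBirkhoff.dCoeff μ l * FracBirkhoff.rhoHat α β μ x (l + 1) j) *
                (Polynomial.C ((l + 2 - μ) / (l + 2) * FracBirkhoff.recA (l + 1)) *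
                    FracBirkhoff.phi (l + 1)
                  + Polynomial.C (FracBirkhoff.recB μ l) * FracBirkhoff.phi l
                  + Polynomial.C ((l + 1) / (l + 1 - μ) * FracBirkhoff.recCPred μ l) *
                    FracBirkhoff.phi (l - 1)) := by
  open FracBirkhoff in
  have hinj := hx.strictMono.injective
  have h0 := last_ne_zero hN
  have hv := degree_cardinal_lt hinj hN h0
  refine ⟨fun hS => ?_, fun Q hQ => ?_⟩
  · obtain ⟨Q, hQ⟩ := exists_isBirkhoffBasis hx hN hα hβ hμ₁ hμ₂ hS
    refine ⟨Q, hQ, fun Q' hQ' => funext fun j => ?_⟩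
    obtain ⟨p, hp, hQp, hpi⟩ := hQ.exists_lift hx hN hμ₁ hμ₂ j
    rw [hQp]
    apply hQ'.eq_C_add_lift hx hN hα hβ hμ₁ hμ₂ j hp hpi
    have h1 := hQ.eval_one j
    rw [hQp, eval_add, eval_C] at h1
    linarith
  have hS := hQ.tildeSum_ne_zero hx hN hα hβ hμ₁ hμ₂
  refine ⟨hS, ?_, ?_, fun j hj hj' hSj => ?_⟩
  · rw [← hx.lift_cardinal_zero hN hα hβ hμ₁ hμ₂, ← lift_hatPoly hμ₁ hμ₂, ← lift_C_mul,
      ← lift_C_mul, add_assoc, ← map_add]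
    -- At interior nodes `(1+x)` times `hatPoly` for `j = 0` equals `-1`, which cancels the
    -- derivative `1/Γ(1-μ)` of the constant `1`. The multiple of `cardinal x 0` then brings the
    -- value at `1` to zero.
    rw [hQ.eq_C_add_lift hx hN hα hβ hμ₁ hμ₂ 0 (q :=
      C (tauZero α β μ x - 1 / Real.Gamma (1 - μ)) * cardinal x 0 +
        C (1 / Real.Gamma (1 - μ)) * hatPoly α β μ x 0), if_pos rfl, C_1]
    · exact lt_of_le_of_lt (degree_add_le _ _) (max_lt
        (lt_of_le_of_lt (degree_const_mul_le _ _) hv)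
        (lt_of_le_of_lt (degree_const_mul_le _ _) (degree_hatPoly_lt' _ _ _ _ _)))
    · intro i hi hi'
      have h := hx.one_add_mul_eval_hatPoly hN hα hβ hμ₁ hμ₂ hi' h0
      rw [if_neg hi, if_pos rfl] at h
      rw [eval_add, eval_mul, eval_mul, eval_C, eval_C, eval_cardinal hinj hi' h0, if_neg hi,
        if_pos rfl]
      linear_combination 1 / Real.Gamma (1 - μ) * h
    · rw [map_add, lift_C_mul, lift_C_mul, eval_add, eval_mul, eval_mul, eval_C, eval_C,
        hx.eval_one_lift_cardinal_zero hN hα hβ hμ₁ hμ₂, eval_one_lift_hatPoly hμ₁ hμ₂, tauZero,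
        if_neg h0, if_pos rfl]
      generalize 1 / Real.Gamma (1 - μ) = g
      field_simp
      ring
  · rw [← hx.lift_cardinal_zero hN hα hβ hμ₁ hμ₂, ← lift_C_mul]
    rw [hQ.eq_C_add_lift hx hN hα hβ hμ₁ hμ₂ (Fin.last N) (q :=
      C (1 / 2 / tildeSum α β μ x) * cardinal x 0), if_neg h0.symm, C_0, zero_add]
    · exact lt_of_le_of_lt (degree_const_mul_le _ _) hv
    · intro i hi hi'
      rw [eval_mul, eval_cardinal hinj hi' h0, if_neg hi, if_neg hi', if_neg h0.symm]
      simp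
    · rw [lift_C_mul, eval_mul, eval_C, hx.eval_one_lift_cardinal_zero hN hα hβ hμ₁ hμ₂,
        if_pos rfl, if_neg h0.symm]
      field_simp
      simp
  · have hτ := hQ.add_tau_ne_zero hx hN hα hβ hμ₁ hμ₂ hj hj' hSj
    refine ⟨hτ, ?_⟩
    -- The factor `(x + τ_j)/(x_j + τ_j)` equals `1` at `x_j`, so the interior conditions survive,
    -- and `τ_j` is the shift that makes the lift vanish at `1`.
    rw [hQ.eq_C_add_lift hx hN hα hβ hμ₁ hμ₂ j (q := C (1 / (x j + tau α β μ x j)) *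
      ((X + C (tau α β μ x j)) * hatPoly α β μ x j)), if_neg hj, C_0, zero_add]
    · rw [← lift_X_mul_hatPoly hμ₁ hμ₂, ← lift_hatPoly hμ₁ hμ₂, lift_C_mul, add_mul, map_add,
        lift_C_mul, div_eq_mul_one_div (tau α β μ x j), C_mul]
      ring
    · exact lt_of_le_of_lt (degree_const_mul_le _ _) (degree_X_add_C_mul_hatPoly_lt hN _ j)
    · intro i hi hi'
      have h := hx.one_add_mul_eval_hatPoly hN hα hβ hμ₁ hμ₂ hi' hj'
      rw [if_neg hj] at h ⊢
      rw [eval_mul, eval_mul, eval_C, eval_add, eval_X, eval_C, zero_div, ← h]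
      by_cases hij : i = j
      · subst hij
        field_simp
      · rw [if_neg hij, sub_zero] at h
        rcases mul_eq_zero.mp h with h | h
        · exact absurd h (by linarith [hx.neg_one_lt hi])
        · rw [h]; ring
    · rw [lift_C_mul, eval_mul, eval_one_lift_X_add_tau_mul_hatPoly (two_le_of_interior hj hj')
        hμ₁ hμ₂ hSj, if_neg hj, if_neg hj']
      simp
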